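/- Let $n\ge 1$ and let $\mathcal F$ be a field of rational functions in $n$ indeterminates over $\mathbb Q$. A (coefficient-free) labeled seed in $\mathcal F$ is a pair $(\mathbf x,B)$, where the cluster $\mathbf x=(x_1,\dots,x_n)$ is an algebraically independent $n$-tuple generating the field $\mathcal F$ over $\mathbb Q$ and $B=(b_{ij})$ is a skew-symmetrizable integer $n\times n$ matrix. Writing $[a]_+=\max(a,0)$, its mutation in direction $k$ is the seed $(\mathbf x',B')$ with $x'_i=x_i$ for $i\ne k$, $$x'_k=x_k^{-1}\Bigl(\prod_{j=1}^n x_j^{[b_{jk}]_+}+\prod_{j=1}^n x_j^{[-b_{jk}]_+}\Bigr),$$ and $b'_{ij}=-b_{ij}$ if $i=k$ or $j=k$, $b'_{ij}=b_{ij}+[b_{ik}]_+b_{kj}+b_{ik}[-b_{kj}]_+$ otherwise. Consider all seeds obtained from one labeled seed by finite sequences of mutations; the entries of their clusters are the cluster variables of the associated coefficient-free cluster algebra. The cluster algebra is of type $A_n$ if, for one of these seeds $(\mathbf x,B)$, the matrix with diagonal entries $2$ and off-diagonal entries $-|b_{ij}|$ is, up to a simultaneous permutation of rows and columns, the Cartan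 matrix of type $A_n$. Theorem. In a coefficient-free cluster algebra of type $A_n$, let $\mathbf x=(x_1,\dots,x_n)$ be the cluster of any of its seeds and let $z$ be any cluster variable. Then $z$ has a unique expression $z=\sum_{m\in\mathbb Z^n}a_m\,x_1^{m_1}\cdots x_n^{m_n}$ as a Laurent polynomial in $\mathbf x$ with integer coefficients, and this Laurent polynomial is log-concave: it is nonzero, all $a_m\ge 0$, and for every $1\le j\le n$ and every $m\in\mathbb Z^n$ $$a_m^2\ \ge\ a_{m-e_j}\,a_{m+e_j},$$ where $e_j$ is the $j$-th standard basis vector. Moreover, if $a_m\ne 0$ then $m_j\in\{-1,0,1\}$ for all $j$; and if $m_j=0$ and $a_{m-e_j}\neq 0\neq a_{m+e_j}$, then $a_{m-e_j}=a_{m+e_j}=1$ and $a_m=2$. -/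

import Mathlib

/-- The data `(x, B)` of a labeled seed of rank `n` with trivial coefficients in a field `F`:
an `n`-tuple of elements of `F` (the cluster) and an integer `n × n` matrix (the exchange matrix).
The conditions that make it a labeled seed are in `Seed.IsLabeledSeed`. -/
structure Seed (n : ℕ) (F : Type*) where
  cluster : Fin n → F
  matrix : Matrix (Fin n) (Fin n) ℤ

/-- `B` is skew-symmetrizable: `D * B` is skew-symmetric for some diagonal matrix `D` with positive
integer diagonal entries. -/
def IsSkewSymmetrizable {n : ℕ} (B : Matrix (Fin n) (Fin n) ℤ) : Prop :=
  ∃ d : Fin n → ℤ, (∀ i, 0 < d i) ∧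
    (Matrix.diagonal d * B).transpose = -(Matrix.diagonal d * B)

/-- Matrix mutation in direction `k`. -/
def mutateMatrix {n : ℕ} (k : Fin n) (B : Matrix (Fin n) (Fin n) ℤ) :
    Matrix (Fin n) (Fin n) ℤ :=
  Matrix.of fun i j =>
    if i = k ∨ j = k then -B i j
    else B i j + max (B i k) 0 * B k j + B i k * max (-B k j) 0

/-- The Cartan counterpart of an exchange matrix: `2` on the diagonal and `-|b i j|` off it. -/
def cartanCounterpart {n : ℕ} (B : Matrix (Fin n) (Fin n) ℤ) : Matrix (Fin n) (Fin n) ℤ :=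
  Matrix.of fun i j => if i = j then 2 else -|B i j|

/-- A Cartan matrix is of type `A_n` if a simultaneous renumbering of its rows and columns turns it
into the standard one (the Dynkin diagram is a path on the `n` vertices). -/
def IsCartanOfTypeA {n : ℕ} (C : Matrix (Fin n) (Fin n) ℤ) : Prop :=
  ∃ σ : Equiv.Perm (Fin n), C.submatrix σ σ = CartanMatrix.A n

namespace Seed

/-- `(x, B)` is a labeled seed of the ambient field `F`: the cluster is algebraically independent
over `ℚ` and generates `F` as a field (so that `F` is a field of rational functions in `n`
indeterminates over `ℚ`), and `B` is skew-symmetrizable. -/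
def IsLabeledSeed {n : ℕ} {F : Type*} [Field F] [CharZero F] (S : Seed n F) : Prop :=
  AlgebraicIndependent ℚ S.cluster ∧
    IntermediateField.adjoin ℚ (Set.range S.cluster) = ⊤ ∧
    IsSkewSymmetrizable S.matrix

/-- Mutation of a coefficient-free seed in direction `k`. -/
def mutate {n : ℕ} {F : Type*} [Field F] (k : Fin n) (S : Seed n F) : Seed n F where
  cluster := fun i =>
    if i = k then
      (S.cluster k)⁻¹ * (∏ j, S.cluster j ^ max (S.matrix j k) 0 +
        ∏ j, S.cluster j ^ max (-S.matrix j k) 0)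
    else S.cluster i
  matrix := mutateMatrix k S.matrix

/-- `S.MutatesTo S'`: a finite (possibly empty) sequence of mutations leads from `S` to `S'`.
For a labeled seed `S`, the seeds `S'` are exactly those of the cluster pattern through `S`,
since the vertices of the `n`-regular tree are the end points of the edge paths from a vertex. -/
def MutatesTo {n : ℕ} {F : Type*} [Field F] (S S' : Seed n F) : Prop :=
  Relation.ReflTransGen (fun R R' : Seed n F => ∃ k, R' = R.mutate k) S S'

/-- The cluster algebra of the cluster pattern through `S` is of type `A_n`: one of its exchange
matrices has Cartan counterpart of type `A_n`. -/
def IsOfTypeA {n : ℕ} {F : Type*} [Field F] (S : Seed n F) : Prop :=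
  ∃ S' : Seed n F, S.MutatesTo S' ∧ IsCartanOfTypeA (cartanCounterpart S'.matrix)

end Seed

/-- Laurent polynomials over `R` in `n` variables: finite `R`-linear combinations of exponent
vectors in `ℤ^n`. -/
abbrev MvLaurent (n : ℕ) (R : Type*) [Semiring R] : Type _ := AddMonoidAlgebra R (Fin n → ℤ)

/-- The value at `x` of a Laurent polynomial with integer coefficients. -/
def MvLaurent.eval {n : ℕ} {F : Type*} [Field F] (x : Fin n → F) (f : MvLaurent n ℤ) : F :=
  f.coeff.sum fun m c => (c : F) * ∏ j, x j ^ m j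

/-- A Laurent polynomial is log-concave if it is nonzero with non-negative coefficients and in each
variable direction the square of every coefficient is at least the product of its two
neighbours. -/
def MvLaurent.IsLogConcave {n : ℕ} {R : Type*} [Semiring R] [PartialOrder R]
    (f : MvLaurent n R) : Prop :=
  f ≠ 0 ∧ (∀ m, 0 ≤ f.coeff m) ∧
    ∀ (j : Fin n) (m : Fin n → ℤ),
      f.coeff (m - Pi.single j 1) * f.coeff (m + Pi.single j 1) ≤ f.coeff m ^ 2

/-! The seeds of type `A_n` are those of triangulations of a polygon with `n + 3` vertices: attach
to each vertex `a` a vector `v a` of the plane over `F`, so that all sides have length `1`, the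
length of the chord `ab` with `a < b` being `det (v a, v b)`. The clusters are the tuples of lengths
of the diagonals in a triangulation, mutation is the flip of a diagonal, and the exchange relation
is Ptolemy's relation, i.e. the Plücker relation between determinants.

To expand the length of `ab` in a triangulation, cut the polygon along one of its diagonals `uw`
that crosses `ab`, and let `uzw` be the triangle at `uw` on the side of `a`. If `a` is not `z`, then
it is cut off by `uz` or by `zw`, say by `uz`, and Ptolemy's relation `uz * aw = au * zw + az * uw`
together with induction on the number of diagonals on this side of `uw` expands `au` and `aw` in
`uw` and the diagonals on this side; `uw` occurs with exponents `0` and `1` only. The expansions of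
`bu` and `bw` involve `uw` and the diagonals on the other side, and the two halves are glued by
`uw * ab = au * wb + aw * ub`. Hence the exponents of `uw` in the expansion of `ab` are `-1`, `0`
and `1`, and nonzero coefficients at both `-1` and `1` arise only in the pattern `1, 2, 1`. As
expansions are unique, this holds for every crossed diagonal; the other diagonals occur with
exponents `0` and `1` only. Log-concavity follows from the pattern. -/

section Algebra

variable {ι K L : Type*} [Field K] [Field L] [Algebra K L] {x y : ι → L}

theorem algebraicIndependent_of_adjoin_eq_top [Finite ι] (hx : AlgebraicIndependent K x)
    (hy : IntermediateField.adjoin K (Set.range y) = ⊤) : AlgebraicIndependent K y := by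
  have : Algebra.IsAlgebraic (Algebra.adjoin K (Set.range y)) L := by
    refine ⟨fun z => ?_⟩
    have hz : z ∈ IntermediateField.adjoin K (Set.range y) := hy ▸ IntermediateField.mem_top
    obtain ⟨r, hr, s, hs, rfl⟩ := IntermediateField.mem_adjoin_iff_div.1 hz
    rw [div_eq_mul_inv]
    exact (isAlgebraic_algebraMap (A := L) (⟨r, hr⟩ : Algebra.adjoin K (Set.range y))).mul
      (isAlgebraic_algebraMap (A := L) (⟨s, hs⟩ : Algebra.adjoin K (Set.range y))).inv
  exact (Algebra.IsAlgebraic.isTranscendenceBasis_of_lift_le_trdeg_of_finite K y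
    hx.lift_cardinalMk_le_trdeg).1

theorem prod_zpow_add_prod_zpow_ne_zero [Fintype ι] [NeZero (2 : K)]
    (hx : AlgebraicIndependent K x) {d e : ι → ℤ} (hd : 0 ≤ d) (he : 0 ≤ e) :
    ∏ j, x j ^ d j + ∏ j, x j ^ e j ≠ 0 := by
  intro h0
  lift d to ι → ℕ using hd
  lift e to ι → ℕ using he
  have hp : MvPolynomial.aeval x
      (∏ j, MvPolynomial.X j ^ d j + ∏ j, MvPolynomial.X j ^ e j : MvPolynomial ι K) = 0 := by
    simpa using h0
  have h1 := congrArg (MvPolynomial.eval fun _ => (1 : K)) (hx.eq_zero_of_aeval_eq_zero _ hp)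
  simp [one_add_one_eq_two, NeZero.ne] at h1

end Algebra

section LabeledSeeds

variable {n : ℕ} {B : Matrix (Fin n) (Fin n) ℤ}

theorem isSkewSymmetrizable_iff :
    IsSkewSymmetrizable B ↔
      ∃ d : Fin n → ℤ, (∀ i, 0 < d i) ∧ ∀ i j, d j * B j i = -(d i * B i j) := by
  unfold IsSkewSymmetrizable
  simp [← Matrix.ext_iff, Matrix.diagonal_mul, mul_comm]

theorem IsSkewSymmetrizable.diag_eq_zero (h : IsSkewSymmetrizable B) (k : Fin n) :
    B k k = 0 := by
  obtain ⟨d, hd, h⟩ := isSkewSymmetrizable_iff.1 h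
  exact (mul_eq_zero.1 (self_eq_neg.1 (h k k))).resolve_left (hd k).ne'

theorem IsSkewSymmetrizable.mutateMatrix (h : IsSkewSymmetrizable B) (k : Fin n) :
    IsSkewSymmetrizable (mutateMatrix k B) := by
  obtain ⟨d, hd, h⟩ := isSkewSymmetrizable_iff.1 h
  have mul_max : ∀ i j, d i * max (B i j) 0 = d j * max (-B j i) 0 := fun i j => by
    rw [mul_max_of_nonneg _ _ (hd i).le, mul_max_of_nonneg _ _ (hd j).le, h j i]
    simp only [mul_neg, mul_zero]
  refine isSkewSymmetrizable_iff.2 ⟨d, hd, fun i j => ?_⟩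
  simp only [_root_.mutateMatrix, Matrix.of_apply]
  by_cases hij : i = k ∨ j = k
  · rw [if_pos hij, if_pos hij.symm]
    linear_combination -h i j
  · rw [if_neg hij, if_neg (mt Or.symm hij)]
    linear_combination h i j + B k i * mul_max j k + B k j * mul_max i k
      + max (-B k j) 0 * h i k + max (-B k i) 0 * h j k

theorem mutateMatrix_mutateMatrix (k : Fin n) (B : Matrix (Fin n) (Fin n) ℤ) :
    mutateMatrix k (mutateMatrix k B) = B := by
  ext i j
  by_cases hij : i = k ∨ j = k
  · simp [mutateMatrix, hij]
  · simp only [mutateMatrix, Matrix.of_apply, hij, if_false, or_true, true_or, if_true, neg_neg]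
    rcases le_total (B i k) 0 with hi | hi <;> rcases le_total (B k j) 0 with hj | hj <;>
      simp [hi, hj]

namespace Seed

variable {F : Type*} [Field F]

theorem mutate_cluster_of_ne (S : Seed n F) {k i : Fin n} (h : i ≠ k) :
    (S.mutate k).cluster i = S.cluster i :=
  if_neg h

theorem mutate_cluster_self (S : Seed n F) (k : Fin n) :
    (S.mutate k).cluster k = (S.cluster k)⁻¹ * (∏ j, S.cluster j ^ max (S.matrix j k) 0 +
        ∏ j, S.cluster j ^ max (-S.matrix j k) 0) :=
  if_pos rfl

theorem prod_mutate_cluster_zpow (S : Seed n F) (k : Fin n) {e : Fin n → ℤ} (he : e k = 0) :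
    ∏ j, (S.mutate k).cluster j ^ e j = ∏ j, S.cluster j ^ e j := by
  refine Finset.prod_congr rfl fun j _ => ?_
  by_cases hj : j = k
  · rw [hj, he, zpow_zero, zpow_zero]
  · rw [S.mutate_cluster_of_ne hj]

theorem mutate_mutate (S : Seed n F) (k : Fin n) (hB : S.matrix k k = 0)
    (hk : (S.mutate k).cluster k ≠ 0) : (S.mutate k).mutate k = S := by
  have hcluster : ((S.mutate k).mutate k).cluster = S.cluster := by
    funext i
    by_cases hi : i = k
    · subst hi
      have hcol : ∀ j, (S.mutate i).matrix j i = -S.matrix j i := fun j => by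
        simp [mutate, mutateMatrix]
      rw [mutate_cluster_self] at hk ⊢
      simp only [hcol, neg_neg]
      rw [S.prod_mutate_cluster_zpow i (e := fun j => max (-S.matrix j i) 0) (by simp [hB]),
        S.prod_mutate_cluster_zpow i (e := fun j => max (S.matrix j i) 0) (by simp [hB]),
        mutate_cluster_self, add_comm (∏ j, S.cluster j ^ max (-S.matrix j i) 0), mul_inv, inv_inv,
        inv_mul_cancel_right₀ (right_ne_zero_of_mul hk)]
    · rw [mutate_cluster_of_ne _ hi, mutate_cluster_of_ne _ hi]
  exact congrArg₂ Seed.mk hcluster (mutateMatrix_mutateMatrix k S.matrix)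

namespace IsLabeledSeed

variable [CharZero F] {S S' : Seed n F}

theorem cluster_ne_zero (h : S.IsLabeledSeed) (i : Fin n) : S.cluster i ≠ 0 :=
  h.1.ne_zero i

theorem adjoin_range_mutate_cluster (h : S.IsLabeledSeed) (k : Fin n) :
    IntermediateField.adjoin ℚ (Set.range (S.mutate k).cluster) = ⊤ := by
  rw [eq_top_iff, ← h.2.1, IntermediateField.adjoin_le_iff]
  set E := IntermediateField.adjoin ℚ (Set.range (S.mutate k).cluster)
  have hmem : ∀ i, (S.mutate k).cluster i ∈ E := fun i =>
    IntermediateField.subset_adjoin _ _ ⟨i, rfl⟩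
  have hprod : ∀ e : Fin n → ℤ, e k = 0 → ∏ j, S.cluster j ^ e j ∈ E := fun e he => by
    rw [← S.prod_mutate_cluster_zpow k he]
    exact prod_mem fun j _ => zpow_mem (hmem j) _
  rintro _ ⟨i, rfl⟩
  by_cases hi : i = k
  · subst hi
    have hdiag := h.2.2.diag_eq_zero i
    have hsum := add_mem (hprod (fun j => max (S.matrix j i) 0) (by simp [hdiag]))
      (hprod (fun j => max (-S.matrix j i) 0) (by simp [hdiag]))
    have hne := prod_zpow_add_prod_zpow_ne_zero h.1 (d := fun j => max (S.matrix j i) 0)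
      (e := fun j => max (-S.matrix j i) 0) (fun _ => le_max_right _ _) fun _ => le_max_right _ _
    have hmul := mul_mem hsum (inv_mem (hmem i))
    rwa [mutate_cluster_self, mul_inv, inv_inv, mul_comm (S.cluster i),
      mul_inv_cancel_left₀ hne] at hmul
  · simpa [S.mutate_cluster_of_ne hi] using hmem i

theorem mutate (h : S.IsLabeledSeed) (k : Fin n) : (S.mutate k).IsLabeledSeed :=
  ⟨algebraicIndependent_of_adjoin_eq_top h.1 (h.adjoin_range_mutate_cluster k),
    h.adjoin_range_mutate_cluster k, h.2.2.mutateMatrix k⟩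

theorem of_mutatesTo (h : S.IsLabeledSeed) (hS : S.MutatesTo S') : S'.IsLabeledSeed := by
  induction hS with
  | refl => exact h
  | tail _ hk ih =>
    obtain ⟨k, rfl⟩ := hk
    exact ih.mutate k

theorem mutatesTo_symm (h : S.IsLabeledSeed) (hS : S.MutatesTo S') : S'.MutatesTo S := by
  induction hS with
  | refl => exact .refl
  | @tail T _ hT hk ih =>
    obtain ⟨k, rfl⟩ := hk
    have hL := h.of_mutatesTo hT
    refine .head ⟨k, ?_⟩ ih
    exact (T.mutate_mutate k (hL.2.2.diag_eq_zero k) ((hL.mutate k).cluster_ne_zero k)).symm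

end IsLabeledSeed

end Seed

end LabeledSeeds

section LaurentEval

theorem linearIndependent_prod_zpow {ι K L : Type*} [Fintype ι] [Field K] [Field L] [Algebra K L]
    {x : ι → L} (hx : AlgebraicIndependent K x) :
    LinearIndependent K fun m : ι → ℤ => ∏ j, x j ^ m j := by
  have hmonomial : LinearIndependent K fun s : ι →₀ ℕ => ∏ j, x j ^ s j := by
    have h := (MvPolynomial.basisMonomials ι K).linearIndependent.map'
      (MvPolynomial.aeval x).toLinearMap (LinearMap.ker_eq_bot.2 hx)
    simpa [Function.comp_def, MvPolynomial.aeval_monomial, Finsupp.prod_fintype] using h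
  rw [linearIndependent_iff_finset_linearIndependent]
  intro t
  obtain ⟨N, hN⟩ : ∃ N : ℕ, ∀ m ∈ t, ∀ j, 0 ≤ m j + N := by
    refine ⟨t.sup fun m => Finset.univ.sup fun j => (m j).natAbs, fun m hm j => ?_⟩
    have hj : (m j).natAbs ≤ Finset.univ.sup fun j => (m j).natAbs :=
      Finset.le_sup (f := fun j => (m j).natAbs) (Finset.mem_univ j)
    have ht := hj.trans
      (Finset.le_sup (f := fun m : ι → ℤ => Finset.univ.sup fun j => (m j).natAbs) hm)
    omega
  let shift (m : t) : ι →₀ ℕ := Finsupp.equivFunOnFinite.symm fun j => (m.1 j + N).toNat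
  have hshift : ∀ m j, (shift m j : ℤ) = m.1 j + N := fun m j => Int.toNat_of_nonneg (hN m m.2 j)
  have hinj : Function.Injective shift := fun m m' h => Subtype.ext <| funext fun j => by
    have := DFunLike.congr_fun h j
    have := hshift m j
    have := hshift m' j
    omega
  refine .of_comp (LinearMap.mulRight K (∏ j, x j ^ (N : ℤ))) ?_
  have h := hmonomial.comp shift hinj
  simpa only [Function.comp_def, LinearMap.mulRight_apply, ← Finset.prod_mul_distrib,
    ← zpow_add₀ (hx.ne_zero _), ← zpow_natCast, hshift] using h

variable {n : ℕ} {F : Type*} [Field F]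

/-- The monomials `x ^ m`, as a multiplicative function of the exponent vector `m`. -/
def zpowHom (x : Fin n → F) (hx : ∀ j, x j ≠ 0) : Multiplicative (Fin n → ℤ) →* F where
  toFun m := ∏ j, x j ^ m.toAdd j
  map_one' := by simp
  map_mul' a b := by
    simp only [toAdd_mul, Pi.add_apply, zpow_add₀ (hx _), Finset.prod_mul_distrib]

namespace MvLaurent

variable {x : Fin n → F}

theorem eval_eq_lift (hx : ∀ j, x j ≠ 0) (f : MvLaurent n ℤ) :
    eval x f = AddMonoidAlgebra.lift ℤ F (Fin n → ℤ) (zpowHom x hx) f := by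
  rw [AddMonoidAlgebra.lift_apply']
  simp [eval, zpowHom]

theorem eval_add (hx : ∀ j, x j ≠ 0) (f g : MvLaurent n ℤ) :
    eval x (f + g) = eval x f + eval x g := by
  simp only [eval_eq_lift hx, map_add]

theorem eval_mul (hx : ∀ j, x j ≠ 0) (f g : MvLaurent n ℤ) :
    eval x (f * g) = eval x f * eval x g := by
  simp only [eval_eq_lift hx, map_mul]

theorem eval_injective [CharZero F] (hx : AlgebraicIndependent ℚ x) :
    Function.Injective (eval x) := fun f g h => by
  refine AddMonoidAlgebra.coeff_injective ((linearIndependent_prod_zpow hx).restrict_scalars'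
    ℤ ?_)
  simpa [eval, Finsupp.linearCombination_apply, zsmul_eq_mul] using h

/-- The Laurent monomial with exponent vector `m`. -/
noncomputable def monomial (m : Fin n → ℤ) : MvLaurent n ℤ := AddMonoidAlgebra.single m 1

theorem eval_monomial (x : Fin n → F) (m : Fin n → ℤ) :
    eval x (monomial m) = ∏ j, x j ^ m j := by
  simp [eval, monomial]

theorem eval_monomial_single (x : Fin n → F) (k : Fin n) (e : ℤ) :
    eval x (monomial (Pi.single k e)) = x k ^ e := by
  rw [eval_monomial, Finset.prod_eq_single k (fun j _ hj => by simp [hj]) (by simp),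
    Pi.single_eq_same]

theorem coeff_mul_monomial (f : MvLaurent n ℤ) (v m : Fin n → ℤ) :
    (f * monomial v).coeff m = f.coeff (m - v) := by
  rw [monomial, AddMonoidAlgebra.coeff_mul_single_eq_coeff_mul (m - v), mul_one]
  exact fun _ _ => eq_sub_iff_add_eq.symm

theorem coeff_monomial (v m : Fin n → ℤ) :
    (monomial v).coeff m = if v = m then 1 else 0 := by
  rw [monomial, AddMonoidAlgebra.coeff_single, Finsupp.single_apply]

end MvLaurent

end LaurentEval

section HalfExpansion

variable {n : ℕ}

/-- Properties of a Laurent polynomial `U` expressing the length of a diagonal that joins a vertex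
on one side of the diagonal number `k` to an end of that diagonal. Here `s` is the set of diagonals
on that side, and `r` a set of diagonals whose variables are allowed in the denominator. -/
structure IsSideExpansion (k : Fin n) (s r : Set (Fin n)) (U : MvLaurent n ℤ) : Prop where
  nonneg : ∀ m, 0 ≤ U.coeff m
  exponent_eq_zero : ∀ m j, U.coeff m ≠ 0 → j ≠ k → j ∉ s → m j = 0
  exponent : ∀ m j, U.coeff m ≠ 0 → j ∉ r → m j = 0 ∨ m j = 1
  exponent_self : ∀ m, U.coeff m ≠ 0 → m k = 0 ∨ m k = 1
  eq_one_of_succ : ∀ m, U.coeff m ≠ 0 → U.coeff (m + Pi.single k 1) ≠ 0 →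
    U.coeff m = 1 ∧ U.coeff (m + Pi.single k 1) = 1

/-- Properties of the Laurent polynomials `U`, `W` expressing the distances of a vertex on one side
of the diagonal number `k` from the two ends of that diagonal. -/
structure HalfExpansion (k : Fin n) (s r : Set (Fin n)) (U W : MvLaurent n ℤ) : Prop where
  notMem : k ∉ s
  left : IsSideExpansion k s r U
  right : IsSideExpansion k s r W
  exponent_self_eq_zero :
    (∀ m, U.coeff m ≠ 0 → m k = 0) ∨ ∀ m, W.coeff m ≠ 0 → m k = 0
  disjoint_left : ∀ m, U.coeff m ≠ 0 → W.coeff (m + Pi.single k 1) = 0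
  disjoint_right : ∀ m, W.coeff m ≠ 0 → U.coeff (m + Pi.single k 1) = 0
  eq_one_of_shared : ∀ m, U.coeff m ≠ 0 → W.coeff m ≠ 0 → U.coeff m = 1 ∧ W.coeff m = 1

theorem HalfExpansion.swap {k : Fin n} {s r : Set (Fin n)} {U W : MvLaurent n ℤ}
    (h : HalfExpansion k s r U W) : HalfExpansion k s r W U where
  notMem := h.notMem
  left := h.right
  right := h.left
  exponent_self_eq_zero := h.exponent_self_eq_zero.symm
  disjoint_left := h.disjoint_right
  disjoint_right := h.disjoint_left
  eq_one_of_shared m h1 h2 := (h.eq_one_of_shared m h2 h1).symm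

/-- The exponent vector of the length of a diagonal in `t` (a variable) or of a side of the polygon
(the constant `1`). -/
def IsVarExponent (t : Set (Fin n)) (c : Fin n → ℤ) : Prop :=
  c = 0 ∨ ∃ j ∈ t, c = Pi.single j 1

namespace IsVarExponent

variable {t : Set (Fin n)} {c : Fin n → ℤ}

theorem apply_eq_zero (h : IsVarExponent t c) {j : Fin n} (hj : j ∉ t) : c j = 0 := by
  rcases h with rfl | ⟨i, hi, rfl⟩
  · rfl
  · exact Pi.single_eq_of_ne (fun e : j = i => hj (e ▸ hi)) 1

theorem apply (h : IsVarExponent t c) (j : Fin n) : c j = 0 ∨ c j = 1 := by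
  rcases h with rfl | ⟨i, -, rfl⟩
  · exact .inl rfl
  · rcases eq_or_ne j i with rfl | hj
    · exact .inr (Pi.single_eq_same ..)
    · exact .inl (Pi.single_eq_of_ne hj 1)

end IsVarExponent

namespace MvLaurent

theorem coeff_monomial_self (c : Fin n → ℤ) : (monomial c).coeff c = 1 := by
  rw [coeff_monomial, if_pos rfl]

theorem coeff_monomial_ne_zero {c m : Fin n → ℤ} : (monomial c).coeff m ≠ 0 ↔ m = c := by
  simp [coeff_monomial, eq_comm]

theorem coeff_monomial_nonneg (c m : Fin n → ℤ) : 0 ≤ (monomial c).coeff m := by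
  rw [coeff_monomial]
  split_ifs <;> norm_num

theorem coeff_mul_monomial_single_neg_one (f : MvLaurent n ℤ) (k : Fin n) (m : Fin n → ℤ) :
    (f * monomial (Pi.single k (-1))).coeff m = f.coeff (m + Pi.single k 1) := by
  rw [coeff_mul_monomial, Pi.single_neg, sub_neg_eq_add]

end MvLaurent

open MvLaurent

section Base

variable {k : Fin n} {s : Set (Fin n)} {c c' : Fin n → ℤ}

theorem IsVarExponent.coeff_monomial_add_single (hk : k ∉ s) (hc : IsVarExponent s c)
    (hc' : IsVarExponent s c') : (monomial c').coeff (c + Pi.single k 1) = 0 := by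
  by_contra h
  have hck := congrFun (coeff_monomial_ne_zero.1 h) k
  simp [hc.apply_eq_zero hk, hc'.apply_eq_zero hk] at hck

theorem IsSideExpansion.monomial (r : Set (Fin n)) (hk : k ∉ s) (hc : IsVarExponent s c) :
    IsSideExpansion k s r (monomial c) where
  nonneg := coeff_monomial_nonneg c
  exponent_eq_zero m j hm _ hj := by
    rw [coeff_monomial_ne_zero.1 hm, hc.apply_eq_zero hj]
  exponent m j hm _ := coeff_monomial_ne_zero.1 hm ▸ hc.apply j
  exponent_self m hm := coeff_monomial_ne_zero.1 hm ▸ hc.apply k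
  eq_one_of_succ m hm hm' := by
    rw [coeff_monomial_ne_zero.1 hm, hc.coeff_monomial_add_single hk hc] at hm'
    exact (hm' rfl).elim

theorem HalfExpansion.monomial (r : Set (Fin n)) (hk : k ∉ s) (hc : IsVarExponent s c)
    (hc' : IsVarExponent s c') :
    HalfExpansion k s r (monomial c) (MvLaurent.monomial c') where
  notMem := hk
  left := .monomial r hk hc
  right := .monomial r hk hc'
  exponent_self_eq_zero := .inl fun m hm => by
    rw [coeff_monomial_ne_zero.1 hm, hc.apply_eq_zero hk]
  disjoint_left m hm := by
    rw [coeff_monomial_ne_zero.1 hm, hc.coeff_monomial_add_single hk hc']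
  disjoint_right m hm := by
    rw [coeff_monomial_ne_zero.1 hm, hc'.coeff_monomial_add_single hk hc]
  eq_one_of_shared m hm hm' := by
    obtain rfl := coeff_monomial_ne_zero.1 hm
    obtain rfl := coeff_monomial_ne_zero.1 hm'
    exact ⟨coeff_monomial_self m, coeff_monomial_self m⟩

end Base

/-- The side `s'` of the diagonal `k'` arises from the side `s` of the diagonal `k` by adding a
triangle with sides `k`, `k'` and a third side with exponent vector `c`. -/
structure IsEnlargement (k : Fin n) (s : Set (Fin n)) (k' : Fin n) (s' : Set (Fin n))
    (c : Fin n → ℤ) : Prop where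
  notMem : k' ∉ s'
  subset : s ⊆ s'
  mem : k ∈ s'
  isVarExponent : IsVarExponent {j | j ∈ s' ∧ j ∉ s ∧ j ≠ k} c

/-- The expansion, by Ptolemy's relation, of the distance to the vertex that is reached by passing
from the diagonal `k` through a triangle with further sides `k'` and a side of exponent vector
`c`. -/
noncomputable def MvLaurent.cross (k k' : Fin n) (c : Fin n → ℤ) (U W : MvLaurent n ℤ) :
    MvLaurent n ℤ :=
  (U * monomial (Pi.single k' 1) + W * monomial c) * monomial (Pi.single k (-1))

section Cross

variable {k k' : Fin n} {s s' r : Set (Fin n)} {c : Fin n → ℤ} {U W : MvLaurent n ℤ}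

theorem MvLaurent.coeff_cross (m : Fin n → ℤ) :
    (cross k k' c U W).coeff m =
      U.coeff (m + Pi.single k 1 - Pi.single k' 1) + W.coeff (m + Pi.single k 1 - c) := by
  rw [cross, coeff_mul_monomial_single_neg_one, AddMonoidAlgebra.coeff_add, Finsupp.add_apply,
    coeff_mul_monomial, coeff_mul_monomial]

namespace IsEnlargement

theorem ne (hs : IsEnlargement k s k' s' c) : k' ≠ k := fun h => hs.notMem (h ▸ hs.mem)

theorem ne_of_notMem (hs : IsEnlargement k s k' s' c) {j : Fin n} (hj : j ∉ s') : j ≠ k :=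
  fun h => hj (h ▸ hs.mem)

theorem exponent_new (hs : IsEnlargement k s k' s' c) (hU : IsSideExpansion k s r U)
    {m : Fin n → ℤ} (hm : U.coeff m ≠ 0) : m k' = 0 :=
  hU.exponent_eq_zero m k' hm hs.ne fun h => hs.notMem (hs.subset h)

theorem coeff_cross_of_ne_one (hs : IsEnlargement k s k' s' c) (h : HalfExpansion k s r U W)
    {m : Fin n → ℤ} (hm : m k' ≠ 1) :
    (cross k k' c U W).coeff m = W.coeff (m + Pi.single k 1 - c) := by
  rw [coeff_cross, add_eq_right]
  by_contra hU
  have := hs.exponent_new h.left hU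
  simp only [Pi.sub_apply, Pi.add_apply, Pi.single_eq_of_ne hs.ne, Pi.single_eq_same] at this
  omega

theorem coeff_cross_of_ne_zero (hs : IsEnlargement k s k' s' c) (h : HalfExpansion k s r U W)
    {m : Fin n → ℤ} (hm : m k' ≠ 0) :
    (cross k k' c U W).coeff m = U.coeff (m + Pi.single k 1 - Pi.single k' 1) := by
  rw [coeff_cross, add_eq_left]
  by_contra hW
  have := hs.exponent_new h.right hW
  have hck' : c k' = 0 := hs.isVarExponent.apply_eq_zero fun h => hs.notMem h.1
  simp only [Pi.sub_apply, Pi.add_apply, Pi.single_eq_of_ne hs.ne, hck'] at this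
  omega

theorem coeff_cross_cases (hs : IsEnlargement k s k' s' c) (h : HalfExpansion k s r U W)
    {m : Fin n → ℤ} (hm : (cross k k' c U W).coeff m ≠ 0) :
    m k' = 1 ∧ U.coeff (m + Pi.single k 1 - Pi.single k' 1) ≠ 0 ∨
      m k' = 0 ∧ W.coeff (m + Pi.single k 1 - c) ≠ 0 := by
  by_cases h1 : m k' = 1
  · rw [hs.coeff_cross_of_ne_zero h (by omega)] at hm
    exact .inl ⟨h1, hm⟩
  · refine .inr ⟨?_, by rwa [hs.coeff_cross_of_ne_one h h1] at hm⟩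
    by_contra h0
    have hU := hs.exponent_new h.left (hs.coeff_cross_of_ne_zero h h0 ▸ hm)
    simp only [Pi.sub_apply, Pi.add_apply, Pi.single_eq_of_ne hs.ne, Pi.single_eq_same] at hU
    omega

theorem eq_zero_of_coeff_sub_ne_zero (hs : IsEnlargement k s k' s' c)
    (hU : IsSideExpansion k s r U) (hW : IsSideExpansion k s r W) {m : Fin n → ℤ} {a : ℤ}
    (hm : U.coeff (m + Pi.single k a) ≠ 0) (hm' : W.coeff (m + Pi.single k 1 - c) ≠ 0) :
    c = 0 := by
  obtain hc | ⟨j, ⟨-, hjs, hjk⟩, rfl⟩ := hs.isVarExponent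
  · exact hc
  · have e1 := hU.exponent_eq_zero _ j hm hjk hjs
    have e2 := hW.exponent_eq_zero _ j hm' hjk hjs
    simp only [Pi.sub_apply, Pi.add_apply, Pi.single_eq_of_ne hjk, Pi.single_eq_same] at e1 e2
    omega

theorem exponent_cross (hs : IsEnlargement k s k' s' c) (h : HalfExpansion k s r U W)
    (hkr : k ∈ r) (m : Fin n → ℤ) (j : Fin n) (hm : (cross k k' c U W).coeff m ≠ 0)
    (hj : j ∉ r) : m j = 0 ∨ m j = 1 := by
  have hjk : j ≠ k := fun e => hj (e ▸ hkr)
  rcases eq_or_ne j k' with rfl | hjk'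
  · exact (hs.coeff_cross_cases h hm).symm.imp And.left And.left
  obtain ⟨-, hU⟩ | ⟨-, hW⟩ := hs.coeff_cross_cases h hm
  · simpa [Pi.single_eq_of_ne hjk', Pi.single_eq_of_ne hjk] using h.left.exponent _ j hU hj
  · have h1 := h.right.exponent _ j hW hj
    have h2 := hs.isVarExponent.apply j
    have h3 : c j = 1 → (m + Pi.single k 1 - c : Fin n → ℤ) j = 0 := fun hcj =>
      h.right.exponent_eq_zero _ j hW hjk fun hjs => by
        have := hs.isVarExponent.apply_eq_zero (j := j) fun h => h.2.1 hjs
        omega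
    simp only [Pi.sub_apply, Pi.add_apply, Pi.single_eq_of_ne hjk] at h1 h3
    omega

theorem isSideExpansion_right (hs : IsEnlargement k s k' s' c) (hW : IsSideExpansion k s r W) :
    IsSideExpansion k' s' r W where
  nonneg := hW.nonneg
  exponent_eq_zero m j hm _ hj :=
    hW.exponent_eq_zero m j hm (hs.ne_of_notMem hj) fun h => hj (hs.subset h)
  exponent := hW.exponent
  exponent_self m hm := .inl (hs.exponent_new hW hm)
  eq_one_of_succ m hm hm' := by
    have e1 := hs.exponent_new hW hm
    have e2 := hs.exponent_new hW hm'
    simp [e1] at e2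

theorem isSideExpansion_cross (hs : IsEnlargement k s k' s' c) (h : HalfExpansion k s r U W)
    (hkr : k ∈ r) : IsSideExpansion k' s' r (cross k k' c U W) where
  nonneg m := by
    rw [coeff_cross]
    exact add_nonneg (h.left.nonneg _) (h.right.nonneg _)
  exponent_eq_zero m j hm hjk' hj := by
    have hjk := hs.ne_of_notMem hj
    have hjs : j ∉ s := fun h => hj (hs.subset h)
    have hcj : c j = 0 := hs.isVarExponent.apply_eq_zero fun h => hj h.1
    obtain ⟨-, hU⟩ | ⟨-, hW⟩ := hs.coeff_cross_cases h hm
    · simpa [hjk', hjk] using h.left.exponent_eq_zero _ j hU hjk hjs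
    · simpa [hcj, hjk] using h.right.exponent_eq_zero _ j hW hjk hjs
  exponent := hs.exponent_cross h hkr
  exponent_self m hm := (hs.coeff_cross_cases h hm).symm.imp And.left And.left
  eq_one_of_succ m hm hm' := by
    obtain ⟨h1, -⟩ | ⟨h0, hW⟩ := hs.coeff_cross_cases h hm
    · have := (hs.coeff_cross_cases h hm').imp And.left And.left
      simp [h1] at this
    · have hsucc : (m + Pi.single k' 1 : Fin n → ℤ) k' ≠ 0 := by simp [h0]
      rw [hs.coeff_cross_of_ne_zero h hsucc, add_right_comm, add_sub_cancel_right] at hm' ⊢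
      rw [hs.coeff_cross_of_ne_one h (by omega)]
      obtain rfl := hs.eq_zero_of_coeff_sub_ne_zero h.left h.right hm' hW
      rw [sub_zero] at hW ⊢
      exact (h.eq_one_of_shared _ hm' hW).symm

end IsEnlargement

theorem HalfExpansion.cross (h : HalfExpansion k s r U W) (hs : IsEnlargement k s k' s' c)
    (hkr : k ∈ r) : HalfExpansion k' s' r (cross k k' c U W) W where
  notMem := hs.notMem
  left := hs.isSideExpansion_cross h hkr
  right := hs.isSideExpansion_right h.right
  exponent_self_eq_zero := .inr fun _ => hs.exponent_new h.right
  disjoint_left m hm := by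
    by_contra hW
    have h1 := (hs.coeff_cross_cases h hm).imp And.left And.left
    have h2 := hs.exponent_new h.right hW
    simp only [Pi.add_apply, Pi.single_eq_same] at h2
    omega
  disjoint_right m hm := by
    have hsucc : (m + Pi.single k' 1 : Fin n → ℤ) k' ≠ 0 := by simp [hs.exponent_new h.right hm]
    rw [hs.coeff_cross_of_ne_zero h hsucc, add_right_comm, add_sub_cancel_right]
    exact h.disjoint_right m hm
  eq_one_of_shared m hm hW := by
    have h0 := hs.exponent_new h.right hW
    rw [hs.coeff_cross_of_ne_one h (by omega)] at hm ⊢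
    obtain rfl := hs.eq_zero_of_coeff_sub_ne_zero (m := m) (a := 0) h.right h.right
      (by simpa using hW) hm
    rw [sub_zero] at hm ⊢
    exact (h.right.eq_one_of_succ m hW hm).symm

end Cross

section Glue

variable {k : Fin n} {s s' r : Set (Fin n)} {U W U' W' : MvLaurent n ℤ} {p q m : Fin n → ℤ}

theorem MvLaurent.coeff_mul_of_separated (hk : k ∉ s) {U V : MvLaurent n ℤ}
    (hU : ∀ m j, U.coeff m ≠ 0 → j ≠ k → j ∉ s → m j = 0)
    (hUk : ∀ m, U.coeff m ≠ 0 → m k = 0 ∨ m k = 1)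
    (hV : ∀ m j, V.coeff m ≠ 0 → j ∈ s → m j = 0)
    (hp : ∀ j ∉ s, p j = 0) (hq : ∀ j ∈ s, q j = 0) :
    (U * V).coeff (p + q) =
      U.coeff p * V.coeff q + U.coeff (p + Pi.single k 1) * V.coeff (q - Pi.single k 1) := by
  classical
  have hne : p ≠ p + Pi.single k 1 := by simp
  have hsupp : ∀ m, U.coeff m * V.coeff (-m + (p + q)) ≠ 0 →
      m ∈ ({p, p + Pi.single k 1} : Finset (Fin n → ℤ)) := fun m hm => by
    obtain ⟨hmU, hmV⟩ := mul_ne_zero_iff.1 hm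
    have hoff : ∀ j, j ≠ k → m j = p j := fun j hj => by
      by_cases hjs : j ∈ s
      · have := hV _ j hmV hjs
        simp only [Pi.add_apply, Pi.neg_apply, hq j hjs] at this
        omega
      · rw [hU _ j hmU hj hjs, hp j hjs]
    rw [Finset.mem_insert, Finset.mem_singleton]
    refine (hUk m hmU).imp (fun h => funext fun j => ?_) fun h => funext fun j => ?_ <;>
      rcases eq_or_ne j k with rfl | hj
    · rw [h, hp j hk]
    · exact hoff j hj
    · rw [h, Pi.add_apply, hp j hk, Pi.single_eq_same, zero_add]
    · rw [hoff j hj, Pi.add_apply, Pi.single_eq_of_ne hj, add_zero]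
  rw [AddMonoidAlgebra.coeff_mul_apply_left, Finsupp.sum_of_support_subset _
    Finset.subset_union_left _ (fun _ _ => zero_mul _),
    ← Finset.sum_subset (Finset.subset_union_right (s₂ := {p, p + Pi.single k 1}))
    (fun m _ hm => not_not.1 (mt (hsupp m) hm)), Finset.sum_pair hne]
  congr 3 <;> abel

/-- The expansion, by Ptolemy's relation, of the distance between two vertices on different sides of
the diagonal `k`: `U`, `W` and `U'`, `W'` are their distances from the ends of that diagonal. -/
noncomputable def MvLaurent.glue (k : Fin n) (U W U' W' : MvLaurent n ℤ) : MvLaurent n ℤ :=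
  (U * W' + W * U') * monomial (Pi.single k (-1))

theorem MvLaurent.glue_swap (k : Fin n) (U W U' W' : MvLaurent n ℤ) :
    glue k W U W' U' = glue k U W U' W' := by
  rw [glue, glue, add_comm]

theorem IsSideExpansion.coeff_add_single_eq_zero (hU : IsSideExpansion k s r U) {a : ℤ}
    (ha : m k + a < 0 ∨ 1 < m k + a) : U.coeff (m + Pi.single k a) = 0 := by
  by_contra h
  have := hU.exponent_self _ h
  simp only [Pi.add_apply, Pi.single_eq_same] at this
  omega

theorem exists_add_eq_of_set (s : Set (Fin n)) (m : Fin n → ℤ) :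
    ∃ p q : Fin n → ℤ, (∀ j ∉ s, p j = 0) ∧ (∀ j ∈ s, q j = 0) ∧ p + q = m :=
  ⟨s.indicator m, sᶜ.indicator m, fun _ hj => Set.indicator_of_notMem hj m,
    fun _ hj => Set.indicator_of_notMem (Set.notMem_compl_iff.2 hj) m,
    Set.indicator_self_add_compl s m⟩

namespace HalfExpansion

theorem coeff_glue (h : HalfExpansion k s r U W) (h' : HalfExpansion k s' r U' W')
    (hd : Disjoint s s') (hp : ∀ j ∉ s, p j = 0) (hq : ∀ j ∈ s, q j = 0) :
    (glue k U W U' W').coeff (p + q) =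
      U.coeff p * W'.coeff (q + Pi.single k 1) + U.coeff (p + Pi.single k 1) * W'.coeff q +
        (W.coeff p * U'.coeff (q + Pi.single k 1) +
          W.coeff (p + Pi.single k 1) * U'.coeff q) := by
  have hs : ∀ j ∈ s, j ≠ k ∧ j ∉ s' := fun j hj =>
    ⟨fun e => h.notMem (e ▸ hj), fun hj' => Set.disjoint_left.1 hd hj hj'⟩
  have hqe : ∀ j ∈ s, (q + Pi.single k 1 : Fin n → ℤ) j = 0 := fun j hj => by
    rw [Pi.add_apply, hq j hj, Pi.single_eq_of_ne (hs j hj).1, add_zero]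
  rw [glue, coeff_mul_monomial_single_neg_one, add_assoc, AddMonoidAlgebra.coeff_add,
    Finsupp.add_apply,
    coeff_mul_of_separated h.notMem h.left.exponent_eq_zero h.left.exponent_self
      (fun m j hm hj => h'.right.exponent_eq_zero m j hm (hs j hj).1 (hs j hj).2) hp hqe,
    coeff_mul_of_separated h.notMem h.right.exponent_eq_zero h.right.exponent_self
      (fun m j hm hj => h'.left.exponent_eq_zero m j hm (hs j hj).1 (hs j hj).2) hp hqe,
    add_sub_cancel_right]

theorem coeff_glue_nonneg (h : HalfExpansion k s r U W) (h' : HalfExpansion k s' r U' W')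
    (hd : Disjoint s s') (m : Fin n → ℤ) : 0 ≤ (glue k U W U' W').coeff m := by
  obtain ⟨p, q, hp, hq, rfl⟩ := exists_add_eq_of_set s m
  rw [h.coeff_glue h' hd hp hq]
  have := h.left.nonneg
  have := h.right.nonneg
  have := h'.left.nonneg
  have := h'.right.nonneg
  refine add_nonneg (add_nonneg ?_ ?_) (add_nonneg ?_ ?_) <;> apply mul_nonneg <;>
    apply_assumption

theorem exists_of_coeff_glue_ne_zero (h : HalfExpansion k s r U W)
    (h' : HalfExpansion k s' r U' W') (hd : Disjoint s s') (hp : ∀ j ∉ s, p j = 0)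
    (hq : ∀ j ∈ s, q j = 0) (hm : (glue k U W U' W').coeff (p + q) ≠ 0) :
    ∃ a b : ℤ, (b = 0 ∨ b = 1) ∧
      (U.coeff (p + Pi.single k a) ≠ 0 ∨ W.coeff (p + Pi.single k a) ≠ 0) ∧
      (U'.coeff (q + Pi.single k b) ≠ 0 ∨ W'.coeff (q + Pi.single k b) ≠ 0) := by
  rw [h.coeff_glue h' hd hp hq] at hm
  by_contra! hcon
  have h01 := hcon 0 1 (.inr rfl)
  have h10 := hcon 1 0 (.inl rfl)
  simp only [Pi.single_zero, add_zero] at h01 h10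
  grind

theorem exponent_glue (h : HalfExpansion k s r U W) (h' : HalfExpansion k s' r U' W')
    (hd : Disjoint s s') (hkr : k ∈ r) (hm : (glue k U W U' W').coeff m ≠ 0) {j : Fin n}
    (hj : j ∉ r) : m j = 0 ∨ m j = 1 := by
  obtain ⟨p, q, hp, hq, rfl⟩ := exists_add_eq_of_set s m
  obtain ⟨a, b, -, h1, h2⟩ := h.exists_of_coeff_glue_ne_zero h' hd hp hq hm
  have hjk : j ≠ k := fun e => hj (e ▸ hkr)
  by_cases hjs : j ∈ s
  · have := h1.elim (h.left.exponent _ j · hj) (h.right.exponent _ j · hj)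
    simpa [hjk, hq j hjs] using this
  · have := h2.elim (h'.left.exponent _ j · hj) (h'.right.exponent _ j · hj)
    simpa [hjk, hp j hjs] using this

theorem exponent_self_glue (h : HalfExpansion k s r U W) (h' : HalfExpansion k s' r U' W')
    (hd : Disjoint s s') (hm : (glue k U W U' W').coeff m ≠ 0) :
    m k = -1 ∨ m k = 0 ∨ m k = 1 := by
  obtain ⟨p, q, hp, hq, rfl⟩ := exists_add_eq_of_set s m
  obtain ⟨a, b, hb, -, h2⟩ := h.exists_of_coeff_glue_ne_zero h' hd hp hq hm
  have := h2.elim (h'.left.exponent_self _) (h'.right.exponent_self _)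
  simp only [Pi.add_apply, Pi.single_eq_same] at this
  rw [Pi.add_apply, hp k h.notMem]
  omega

section Pattern

variable (h : HalfExpansion k s r U W) (h' : HalfExpansion k s' r U' W') (hd : Disjoint s s')
  (hp : ∀ j ∉ s, p j = 0) (hq : ∀ j ∈ s, q j = 0) (hqk : q k = 0)

include h h' hd hp hq hqk

theorem coeff_glue_sub_single :
    (glue k U W U' W').coeff (p + q - Pi.single k 1) =
      U.coeff p * W'.coeff q + W.coeff p * U'.coeff q := by
  have hks : ∀ j ∈ s, j ≠ k := fun j hj e => h.notMem (e ▸ hj)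
  have hcoeff := h.coeff_glue h' hd (q := q + Pi.single k (-1)) hp fun j hj => by
    simp [hq j hj, hks j hj]
  rw [add_assoc q, ← Pi.single_add, neg_add_cancel, Pi.single_zero, add_zero,
    h'.left.coeff_add_single_eq_zero (by omega), h'.right.coeff_add_single_eq_zero (by omega),
    mul_zero, mul_zero, add_zero, add_zero] at hcoeff
  rw [sub_eq_add_neg, ← Pi.single_neg, add_assoc, hcoeff]

theorem coeff_glue_add_single :
    (glue k U W U' W').coeff (p + q + Pi.single k 1) =
      U.coeff (p + Pi.single k 1) * W'.coeff (q + Pi.single k 1) +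
        W.coeff (p + Pi.single k 1) * U'.coeff (q + Pi.single k 1) := by
  have hks : ∀ j ∈ s, j ≠ k := fun j hj e => h.notMem (e ▸ hj)
  have hcoeff := h.coeff_glue h' hd (q := q + Pi.single k 1) hp fun j hj => by
    simp [hq j hj, hks j hj]
  rw [add_assoc q, ← Pi.single_add, h'.left.coeff_add_single_eq_zero (by omega),
    h'.right.coeff_add_single_eq_zero (by omega), mul_zero, mul_zero, zero_add, zero_add] at hcoeff
  rw [add_assoc, hcoeff]

theorem glue_pattern_of_right (hl : (glue k U W U' W').coeff (p + q - Pi.single k 1) ≠ 0)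
    (hW : W.coeff (p + Pi.single k 1) ≠ 0) (hU' : U'.coeff (q + Pi.single k 1) ≠ 0) :
    (glue k U W U' W').coeff (p + q - Pi.single k 1) = 1 ∧
      (glue k U W U' W').coeff (p + q + Pi.single k 1) = 1 ∧
      (glue k U W U' W').coeff (p + q) = 2 := by
  have hU0 : U.coeff p = 0 := by_contra fun h0 => hW (h.disjoint_left p h0)
  have hU1 : U.coeff (p + Pi.single k 1) = 0 := by
    by_contra h0
    obtain hU | hW0 := h.exponent_self_eq_zero
    · simpa [hp k h.notMem] using hU _ h0
    · simpa [hp k h.notMem] using hW0 _ hW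
  have hW1' : W'.coeff (q + Pi.single k 1) = 0 := by
    by_contra h0
    obtain hU0 | hW := h'.exponent_self_eq_zero
    · simpa [hqk] using hU0 _ hU'
    · simpa [hqk] using hW _ h0
  rw [coeff_glue_sub_single h h' hd hp hq hqk, hU0, zero_mul, zero_add] at hl ⊢
  obtain ⟨hW0, hU0'⟩ := mul_ne_zero_iff.1 hl
  obtain ⟨eW0, eW1⟩ := h.right.eq_one_of_succ p hW0 hW
  obtain ⟨eU0, eU1⟩ := h'.left.eq_one_of_succ q hU0' hU'
  rw [coeff_glue_add_single h h' hd hp hq hqk, h.coeff_glue h' hd hp hq, hU0, hU1, hW1',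
    eW0, eW1, eU0, eU1]
  norm_num

end Pattern

theorem glue_pattern (h : HalfExpansion k s r U W) (h' : HalfExpansion k s' r U' W')
    (hd : Disjoint s s') (hmk : m k = 0)
    (hl : (glue k U W U' W').coeff (m - Pi.single k 1) ≠ 0)
    (hr : (glue k U W U' W').coeff (m + Pi.single k 1) ≠ 0) :
    (glue k U W U' W').coeff (m - Pi.single k 1) = 1 ∧
      (glue k U W U' W').coeff (m + Pi.single k 1) = 1 ∧ (glue k U W U' W').coeff m = 2 := by
  obtain ⟨p, q, hp, hq, rfl⟩ := exists_add_eq_of_set s m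
  have hqk : q k = 0 := by rwa [Pi.add_apply, hp k h.notMem, zero_add] at hmk
  have hsum := hr
  rw [h.coeff_glue_add_single h' hd hp hq hqk] at hsum
  by_cases hU : U.coeff (p + Pi.single k 1) * W'.coeff (q + Pi.single k 1) = 0
  · rw [hU, zero_add] at hsum
    obtain ⟨hW, hU'⟩ := mul_ne_zero_iff.1 hsum
    exact h.glue_pattern_of_right h' hd hp hq hqk hl hW hU'
  · obtain ⟨hU, hW'⟩ := mul_ne_zero_iff.1 hU
    rw [← glue_swap] at hl ⊢
    exact h.swap.glue_pattern_of_right h'.swap hd hp hq hqk hl hU hW'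

end HalfExpansion

end Glue

end HalfExpansion

section Patterned

variable {n : ℕ} {f : MvLaurent n ℤ}

/-- The behaviour of a Laurent polynomial in the variable number `j`: exponents `-1`, `0`, `1`, and
coefficients `1`, `2`, `1` wherever both extreme exponents occur. -/
structure IsPatterned (f : MvLaurent n ℤ) (j : Fin n) : Prop where
  exponent : ∀ m, f.coeff m ≠ 0 → m j = -1 ∨ m j = 0 ∨ m j = 1
  pattern : ∀ m, m j = 0 → f.coeff (m - Pi.single j 1) ≠ 0 → f.coeff (m + Pi.single j 1) ≠ 0 →
    f.coeff (m - Pi.single j 1) = 1 ∧ f.coeff (m + Pi.single j 1) = 1 ∧ f.coeff m = 2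

theorem IsPatterned.of_exponent {j : Fin n}
    (h : ∀ m, f.coeff m ≠ 0 → m j = 0 ∨ m j = 1) : IsPatterned f j where
  exponent m hm := .inr (h m hm)
  pattern m hmj hl _ := by
    have := h _ hl
    simp only [Pi.sub_apply, Pi.single_eq_same] at this
    omega

theorem HalfExpansion.isPatterned_glue {k : Fin n} {s s' r : Set (Fin n)}
    {U W U' W' : MvLaurent n ℤ} (h : HalfExpansion k s r U W) (h' : HalfExpansion k s' r U' W')
    (hd : Disjoint s s') : IsPatterned (MvLaurent.glue k U W U' W') k where
  exponent _ hm := h.exponent_self_glue h' hd hm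
  pattern _ hmk hl hr := h.glue_pattern h' hd hmk hl hr

theorem MvLaurent.isLogConcave_of_isPatterned (h0 : f ≠ 0) (hf : ∀ m, 0 ≤ f.coeff m)
    (h : ∀ j, IsPatterned f j) : f.IsLogConcave := by
  refine ⟨h0, hf, fun j m => ?_⟩
  by_cases hl : f.coeff (m - Pi.single j 1) = 0
  · rw [hl, zero_mul]
    exact sq_nonneg _
  by_cases hr : f.coeff (m + Pi.single j 1) = 0
  · rw [hr, mul_zero]
    exact sq_nonneg _
  have h1 := (h j).exponent _ hl
  have h2 := (h j).exponent _ hr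
  simp only [Pi.sub_apply, Pi.add_apply, Pi.single_eq_same] at h1 h2
  obtain ⟨e1, e2, e3⟩ := (h j).pattern m (by omega) hl hr
  rw [e1, e2, e3]
  norm_num

end Patterned

section Polygon

/-- The vertices `a`, `b`, `c` of a polygon with vertices numbered `0`, `1`, `2`, … along its
boundary are distinct and met in this cyclic order. -/
def Ccw (a b c : ℕ) : Prop :=
  a < b ∧ b < c ∨ b < c ∧ c < a ∨ c < a ∧ a < b

theorem Ccw.rotate {a b c : ℕ} (h : Ccw a b c) : Ccw b c a := by
  unfold Ccw at *; omega

theorem Ccw.trans_left {a b c d : ℕ} (h : Ccw a b c) (h' : Ccw a c d) : Ccw a b d := by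
  unfold Ccw at *; omega

theorem Ccw.trans_right {a b c d : ℕ} (h : Ccw a b d) (h' : Ccw b c d) : Ccw a c d := by
  unfold Ccw at *; omega

theorem Ccw.eq_or_ccw_or_ccw {a c x : ℕ} (hx : Ccw a x c) (b : ℕ) :
    x = b ∨ Ccw a x b ∨ Ccw b x c := by
  unfold Ccw at *; omega

/-- The chords `e` and `f` of a polygon cross in an interior point. -/
def Crosses (e f : Sym2 ℕ) : Prop :=
  ∃ a b c d, e = s(a, c) ∧ f = s(b, d) ∧ Ccw a b c ∧ Ccw c d a

theorem crosses_mk {a b c d : ℕ} :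
    Crosses s(a, c) s(b, d) ↔ Ccw a b c ∧ Ccw c d a ∨ Ccw c b a ∧ Ccw a d c := by
  constructor
  · rintro ⟨x, y, z, w, hxz, hyw, hy, hw⟩
    obtain ⟨rfl, rfl⟩ | ⟨rfl, rfl⟩ := Sym2.eq_iff.1 hxz <;>
      obtain ⟨rfl, rfl⟩ | ⟨rfl, rfl⟩ := Sym2.eq_iff.1 hyw <;> simp [hy, hw]
  · rintro (⟨hb, hd⟩ | ⟨hb, hd⟩)
    · exact ⟨a, b, c, d, rfl, rfl, hb, hd⟩
    · exact ⟨c, b, a, d, Sym2.eq_swap, rfl, hb, hd⟩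

theorem Crosses.exists_eq_mk {a c : ℕ} {e : Sym2 ℕ} (h : Crosses s(a, c) e) :
    ∃ x y, e = s(x, y) ∧ Ccw a x c ∧ Ccw c y a := by
  induction e with | _ x y =>
  obtain ⟨hx, hy⟩ | ⟨hx, hy⟩ := crosses_mk.1 h
  · exact ⟨x, y, rfl, hx, hy⟩
  · exact ⟨y, x, Sym2.eq_swap, hy, hx⟩

theorem Crosses.symm {e f : Sym2 ℕ} : Crosses e f → Crosses f e := by
  rintro ⟨a, b, c, d, rfl, rfl, hb, hd⟩
  rw [crosses_mk]
  unfold Ccw at *; omega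

variable {n : ℕ}

/-- The sides of the polygon with vertices `0, …, n + 2`. -/
def sides (n : ℕ) : Set (Sym2 ℕ) :=
  {e | (∃ a ≤ n + 1, e = s(a, a + 1)) ∨ e = s(0, n + 2)}

/-- The diagonals of the polygon with vertices `0, …, n + 2`. -/
def diagonals (n : ℕ) : Set (Sym2 ℕ) :=
  {e | ¬e.IsDiag ∧ (∀ x ∈ e, x ≤ n + 2) ∧ e ∉ sides n}

/-- The sides of the polygon with `n + 3` vertices and the diagonals `τ 0, …, τ (n - 1)`. -/
def edges (τ : Fin n → Sym2 ℕ) : Set (Sym2 ℕ) :=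
  sides n ∪ Set.range τ

theorem mk_mem_sides {a c : ℕ} : s(a, c) ∈ sides n ↔
    a + 1 = c ∧ c ≤ n + 2 ∨ c + 1 = a ∧ a ≤ n + 2 ∨ a = 0 ∧ c = n + 2 ∨ c = 0 ∧ a = n + 2 := by
  simp only [sides, Set.mem_ofPred_eq, Sym2.eq_iff]
  constructor
  · rintro (⟨x, hx, h⟩ | h) <;> omega
  · rintro (⟨rfl, h⟩ | ⟨rfl, h⟩ | h | h)
    · exact .inl ⟨a, by omega, by simp⟩
    · exact .inl ⟨c, by omega, by simp⟩
    all_goals exact .inr (by omega)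

theorem mk_mem_diagonals {a c : ℕ} :
    s(a, c) ∈ diagonals n ↔ a ≠ c ∧ a ≤ n + 2 ∧ c ≤ n + 2 ∧ s(a, c) ∉ sides n := by
  simp [diagonals, and_assoc]

theorem not_crosses_of_mem_sides {e f : Sym2 ℕ} (he : e ∈ sides n) (hf : ∀ x ∈ f, x ≤ n + 2) :
    ¬Crosses e f := by
  rintro ⟨a, b, c, d, rfl, rfl, hb, hd⟩
  rw [mk_mem_sides] at he
  have hb' := hf b (Sym2.mem_mk_left b d)
  have hd' := hf d (Sym2.mem_mk_right b d)
  unfold Ccw at *; omega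

variable {τ : Fin n → Sym2 ℕ} {k : Fin n} {a b c d : ℕ}

theorem mem_edges_apply (τ : Fin n → Sym2 ℕ) (k : Fin n) : τ k ∈ edges τ :=
  .inr ⟨k, rfl⟩

theorem exists_eq_of_crosses {e f : Sym2 ℕ} (he : e ∈ edges τ) (hf : ∀ x ∈ f, x ≤ n + 2)
    (hcross : Crosses e f) : ∃ i, τ i = e :=
  he.resolve_left fun hs => not_crosses_of_mem_sides hs hf hcross

theorem edges_update {e : Sym2 ℕ} (hinj : Function.Injective τ) (hk : τ k ∉ sides n) :
    edges (Function.update τ k e) = insert e (edges τ \ {τ k}) := by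
  ext f
  simp only [edges, Set.mem_union, Set.mem_range, Set.mem_insert_iff, Set.mem_sdiff,
    Set.mem_singleton_iff]
  constructor
  · rintro (hf | ⟨j, rfl⟩)
    · exact .inr ⟨.inl hf, fun h => hk (h ▸ hf)⟩
    · rcases eq_or_ne j k with rfl | hj
      · exact .inl (Function.update_self ..)
      · rw [Function.update_of_ne hj]
        exact .inr ⟨.inr ⟨j, rfl⟩, hinj.ne hj⟩
  · rintro (rfl | ⟨hf | ⟨j, rfl⟩, hj⟩)
    · exact .inr ⟨k, Function.update_self ..⟩
    · exact .inl hf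
    · exact .inr ⟨j, Function.update_of_ne (fun h => hj (congrArg τ h)) ..⟩

theorem le_of_mem_edges (hτ : ∀ k, τ k ∈ diagonals n) {e : Sym2 ℕ} (he : e ∈ edges τ) :
    ∀ x ∈ e, x ≤ n + 2 := by
  obtain he | ⟨k, rfl⟩ := he
  · induction e with | _ a c =>
    rw [mk_mem_sides] at he
    simp only [Sym2.mem_iff]
    omega
  · exact (hτ k).2.1

/-- The diagonals `τ 0, …, τ (n - 1)` form a triangulation of the polygon with `n + 3` vertices,
that is, a maximal set of pairwise noncrossing diagonals. -/
structure IsTriangulation (τ : Fin n → Sym2 ℕ) : Prop where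
  injective : Function.Injective τ
  mem_diagonals : ∀ k, τ k ∈ diagonals n
  noncrossing : ∀ e ∈ edges τ, ∀ f ∈ edges τ, ¬Crosses e f
  maximal : ∀ e : Sym2 ℕ, ¬e.IsDiag → (∀ x ∈ e, x ≤ n + 2) → (∀ f ∈ edges τ, ¬Crosses e f) →
    e ∈ edges τ

/-- The edges of `τ` contain the boundary of the quadrilateral with vertices `a`, `b`, `c`, `d`. -/
structure IsQuad (τ : Fin n → Sym2 ℕ) (a b c d : ℕ) : Prop where
  abc : Ccw a b c
  cda : Ccw c d a
  ab : s(a, b) ∈ edges τ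
  bc : s(b, c) ∈ edges τ
  cd : s(c, d) ∈ edges τ
  da : s(d, a) ∈ edges τ

theorem IsQuad.rotate (h : IsQuad τ a b c d) : IsQuad τ b c d a where
  abc := by
    have := h.abc
    have := h.cda
    unfold Ccw at *; omega
  cda := by
    have := h.abc
    have := h.cda
    unfold Ccw at *; omega
  ab := h.bc
  bc := h.cd
  cd := h.da
  da := h.ab

theorem IsQuad.eq_of_crosses (h : IsQuad τ a b c d) {e : Sym2 ℕ} (hac : Crosses s(a, c) e)
    (hab : ¬Crosses s(a, b) e) (hbc : ¬Crosses s(b, c) e) (hcd : ¬Crosses s(c, d) e)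
    (hda : ¬Crosses s(d, a) e) : e = s(b, d) := by
  obtain ⟨x, y, rfl, hx, hy⟩ := hac.exists_eq_mk
  have hb := h.abc
  have hd := h.cda
  have hxb : x = b := by
    obtain hxb | hxb | hxb := hx.eq_or_ccw_or_ccw b
    · exact hxb
    · exact absurd ⟨a, x, b, y, rfl, rfl, hxb, (hb.trans_left hy.rotate.rotate).rotate⟩ hab
    · exact absurd ⟨b, x, c, y, rfl, rfl, hxb, hy.trans_left hb.rotate.rotate⟩ hbc
  have hyd : y = d := by
    obtain hyd | hyd | hyd := hy.eq_or_ccw_or_ccw d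
    · exact hyd
    · exact absurd ⟨c, y, d, x, rfl, Sym2.eq_swap, hyd, (hd.trans_left hx.rotate.rotate).rotate⟩ hcd
    · exact absurd ⟨d, y, a, x, rfl, Sym2.eq_swap, hyd, hx.trans_left hd.rotate.rotate⟩ hda
  rw [hxb, hyd]

namespace IsTriangulation

variable (h : IsTriangulation τ)
include h

theorem le_and_le_of_mem_edges (hac : s(a, c) ∈ edges τ) : a ≤ n + 2 ∧ c ≤ n + 2 :=
  ⟨le_of_mem_edges h.mem_diagonals hac a (Sym2.mem_mk_left a c),
    le_of_mem_edges h.mem_diagonals hac c (Sym2.mem_mk_right a c)⟩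

theorem exists_apex {p : ℕ} (hac : s(a, c) ∈ edges τ) (hp : p ≤ n + 2) (hapc : Ccw a p c) :
    ∃ b, Ccw a b c ∧ s(a, b) ∈ edges τ ∧ s(b, c) ∈ edges τ := by
  classical
  obtain ⟨ha, hc⟩ := h.le_and_le_of_mem_edges hac
  -- the position of a vertex on the boundary path that starts after `a`
  let pos (x : ℕ) : ℕ := if a < x then x else x + n + 3
  let T := (Finset.range (n + 3)).filter fun x => Ccw a x c ∧ s(a, x) ∈ edges τ
  have hT : T.Nonempty := by
    refine ⟨if a = n + 2 then 0 else a + 1, Finset.mem_filter.2 ⟨?_, ?_, .inl ?_⟩⟩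
    · rw [Finset.mem_range]
      split_ifs <;> omega
    · unfold Ccw at *
      split_ifs <;> omega
    · rw [mk_mem_sides]
      split_ifs <;> omega
  obtain ⟨b, hbT, hmax⟩ := T.exists_max_image pos hT
  obtain ⟨hbn, hb, hab⟩ := Finset.mem_filter.1 hbT
  rw [Finset.mem_range] at hbn
  refine ⟨b, hb, hab, h.maximal _ (by rw [Sym2.mk_isDiag_iff]; unfold Ccw at hb; omega)
    (by simp only [Sym2.mem_iff]; omega) fun f hf hcross => ?_⟩
  obtain ⟨x, y, rfl, hx, hy⟩ := hcross.exists_eq_mk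
  obtain rfl : y = a := by
    obtain hya | hya | hya := hy.eq_or_ccw_or_ccw a
    · exact hya
    · exact absurd ⟨a, x, c, y, rfl, rfl, hb.trans_right hx, hya⟩ (h.noncrossing _ hac _ hf)
    · exact absurd ⟨a, y, b, x, rfl, Sym2.eq_swap, hya, hx.trans_left hb.rotate⟩
        (h.noncrossing _ hab _ hf)
  have hxn := (h.le_and_le_of_mem_edges hf).1
  have hpos := hmax x (Finset.mem_filter.2
    ⟨Finset.mem_range.2 (by omega), by unfold Ccw at *; omega, Sym2.eq_swap ▸ hf⟩)
  simp only [pos] at hpos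
  unfold Ccw at *
  split_ifs at hpos <;> omega

theorem apex_unique {b' : ℕ} (hb : Ccw a b c) (hab : s(a, b) ∈ edges τ) (hbc : s(b, c) ∈ edges τ)
    (hb' : Ccw a b' c) (hab' : s(a, b') ∈ edges τ) (hbc' : s(b', c) ∈ edges τ) : b = b' := by
  obtain hbb | hbb | hbb := hb'.eq_or_ccw_or_ccw b
  · exact hbb.symm
  · exact absurd ⟨a, b', b, c, rfl, rfl, hbb, hb.rotate⟩ (h.noncrossing _ hab _ hbc')
  · exact absurd ⟨b, b', c, a, rfl, Sym2.eq_swap, hbb, hb.rotate.rotate⟩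
      (h.noncrossing _ hbc _ hab')

theorem exists_isQuad (k : Fin n) : ∃ a b c d, τ k = s(a, c) ∧ IsQuad τ a b c d := by
  have hk := h.mem_diagonals k
  have hac := mem_edges_apply τ k
  generalize τ k = e at hk hac
  induction e with | _ a c =>
  obtain ⟨hne, ha, hc, hside⟩ := mk_mem_diagonals.1 hk
  rw [mk_mem_sides] at hside
  have hexists : ∀ x y : ℕ, x ≠ y → x ≤ n + 2 → y ≤ n + 2 →
      ¬(x + 1 = y ∨ x = n + 2 ∧ y = 0) → ∃ p ≤ n + 2, Ccw x p y := fun x y _ _ _ _ => by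
    refine ⟨if x = n + 2 then 0 else x + 1, ?_⟩
    unfold Ccw
    split_ifs <;> omega
  obtain ⟨p, hp, hapc⟩ := hexists a c hne ha hc (by omega)
  obtain ⟨q, hq, hcqa⟩ := hexists c a hne.symm hc ha (by omega)
  obtain ⟨b, hb, hab, hbc⟩ := h.exists_apex hac hp hapc
  obtain ⟨d, hd, hcd, hda⟩ := h.exists_apex (Sym2.eq_swap ▸ hac) hq hcqa
  exact ⟨a, b, c, d, rfl, hb, hd, hab, hbc, hcd, hda⟩

end IsTriangulation

namespace IsQuad

theorem crosses (hq : IsQuad τ a b c d) : Crosses s(a, c) s(b, d) :=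
  crosses_mk.2 (.inl ⟨hq.abc, hq.cda⟩)

theorem notMem_edges (hq : IsQuad τ a b c d) (h : IsTriangulation τ) (hk : τ k = s(a, c)) :
    s(b, d) ∉ edges τ :=
  fun hbd => h.noncrossing _ (hk ▸ mem_edges_apply τ k) _ hbd hq.crosses

theorem edges_flip (hk : τ k = s(a, c)) (h : IsTriangulation τ) :
    edges (Function.update τ k s(b, d)) = insert s(b, d) (edges τ \ {s(a, c)}) := by
  rw [edges_update h.injective (h.mem_diagonals k).2.2, hk]

theorem isQuad_flip (hq : IsQuad τ a b c d) (h : IsTriangulation τ) (hk : τ k = s(a, c)) :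
    IsQuad (Function.update τ k s(b, d)) b c d a := by
  have hb := hq.abc
  have hd := hq.cda
  have hbc := hq.rotate.abc
  have mem : ∀ {e}, e ∈ edges τ → e ≠ s(a, c) → e ∈ edges (Function.update τ k s(b, d)) :=
    fun he hne => by
      rw [edges_flip hk h]
      exact .inr ⟨he, hne⟩
  refine ⟨hq.rotate.abc, hq.rotate.cda, mem hq.bc ?_, mem hq.cd ?_, mem hq.da ?_, mem hq.ab ?_⟩ <;>
    · rw [Ne, Sym2.eq_iff]
      unfold Ccw at *; omega

theorem eq_of_mem_edges_of_crosses (hq : IsQuad τ a b c d) (h : IsTriangulation τ) {e : Sym2 ℕ}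
    (he : e ∈ edges τ) (hcross : Crosses s(b, d) e) : e = s(a, c) :=
  (hq.rotate.eq_of_crosses hcross (h.noncrossing _ hq.bc _ he) (h.noncrossing _ hq.cd _ he)
    (h.noncrossing _ hq.da _ he) (h.noncrossing _ hq.ab _ he)).trans Sym2.eq_swap

theorem noncrossing_flip (hq : IsQuad τ a b c d) (h : IsTriangulation τ) (hk : τ k = s(a, c)) :
    ∀ e ∈ edges (Function.update τ k s(b, d)), ∀ f ∈ edges (Function.update τ k s(b, d)),
      ¬Crosses e f := by
  rw [edges_flip hk h]
  rintro e (rfl | ⟨he, hne⟩) f (rfl | ⟨hf, hnf⟩) hcross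
  · rw [crosses_mk] at hcross
    unfold Ccw at hcross; omega
  · exact hnf (hq.eq_of_mem_edges_of_crosses h hf hcross)
  · exact hne (hq.eq_of_mem_edges_of_crosses h he hcross.symm)
  · exact h.noncrossing e he f hf hcross

theorem mem_edges_flip_of_not_crosses (hq : IsQuad τ a b c d) (h : IsTriangulation τ)
    (hk : τ k = s(a, c)) {e : Sym2 ℕ} (hdiag : ¬e.IsDiag) (hle : ∀ x ∈ e, x ≤ n + 2)
    (he : ∀ f ∈ edges (Function.update τ k s(b, d)), ¬Crosses e f) :
    e ∈ edges (Function.update τ k s(b, d)) := by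
  have hq' := hq.isQuad_flip h hk
  have he' : ∀ f ∈ edges (Function.update τ k s(b, d)), ¬Crosses f e :=
    fun f hf hcross => he f hf hcross.symm
  rw [edges_flip hk h] at he' ⊢
  by_cases hac : Crosses s(a, c) e
  · rw [← edges_flip hk h] at he'
    exact .inl (hq.eq_of_crosses hac (he' _ hq'.da) (he' _ hq'.ab) (he' _ hq'.bc) (he' _ hq'.cd))
  · refine .inr ⟨h.maximal e hdiag hle fun f hf hcross => ?_, ?_⟩
    · exact he' f (.inr ⟨hf, fun hfac => hac (hfac ▸ hcross.symm)⟩) hcross.symm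
    · rintro rfl
      exact he' _ (.inl rfl) hq.crosses.symm

theorem isTriangulation_flip (hq : IsQuad τ a b c d) (h : IsTriangulation τ)
    (hk : τ k = s(a, c)) : IsTriangulation (Function.update τ k s(b, d)) where
  injective i j hij := by
    have hbd : ∀ i, τ i ≠ s(b, d) := fun i hi =>
      hq.notMem_edges h hk (hi ▸ mem_edges_apply τ i)
    have := @h.injective i j
    grind [Function.update_apply]
  mem_diagonals i := by
    rcases eq_or_ne i k with rfl | hi
    · rw [Function.update_self, mk_mem_diagonals]
      refine ⟨?_, (h.le_and_le_of_mem_edges hq.ab).2, (h.le_and_le_of_mem_edges hq.cd).2,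
        fun hs => hq.notMem_edges h hk (.inl hs)⟩
      have := hq.rotate.abc
      have := hq.cda
      unfold Ccw at *; omega
    · rw [Function.update_of_ne hi]
      exact h.mem_diagonals i
  noncrossing := hq.noncrossing_flip h hk
  maximal _ := hq.mem_edges_flip_of_not_crosses h hk

end IsQuad

end Polygon

section AdjacencyMatrix

/-- The segments `p`, `q`, `r` are the sides of a triangle, met in this order when its boundary is
run through in the direction of increasing vertex numbers. -/
def IsTriangle (p q r : Sym2 ℕ) : Prop :=
  ∃ x y z, Ccw x y z ∧ p = s(x, y) ∧ q = s(y, z) ∧ r = s(z, x)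

theorem IsTriangle.rotate {p q r : Sym2 ℕ} : IsTriangle p q r → IsTriangle q r p := by
  rintro ⟨x, y, z, h, hp, hq, hr⟩
  exact ⟨y, z, x, h.rotate, hq, hr, hp⟩

theorem IsTriangle.eq {p q r r' : Sym2 ℕ} : IsTriangle p q r → IsTriangle p q r' → r = r' := by
  rintro ⟨x, y, z, h, rfl, rfl, rfl⟩ ⟨x', y', z', h', hp, hq, rfl⟩
  rw [Sym2.eq_iff] at hp hq
  obtain ⟨rfl, rfl⟩ : x = x' ∧ z = z' := by
    unfold Ccw at h h'; omega
  rfl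

open Classical in
/-- The indicator function of the pairs `(p, q)` such that `q` follows `p` in the boundary of a
triangle whose third side is in `E`. -/
noncomputable def followsInd (E : Set (Sym2 ℕ)) (p q : Sym2 ℕ) : ℤ :=
  if ∃ r ∈ E, IsTriangle p q r then 1 else 0

/-- The indicator function of `e`. -/
def edgeInd (e p : Sym2 ℕ) : ℤ := if p = e then 1 else 0

variable {n : ℕ}

/-- The signed adjacency matrix of a triangulation. -/
noncomputable def adjMatrix (τ : Fin n → Sym2 ℕ) : Matrix (Fin n) (Fin n) ℤ :=
  Matrix.of fun i j => followsInd (edges τ) (τ i) (τ j) - followsInd (edges τ) (τ j) (τ i)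

theorem adjMatrix_neg (τ : Fin n → Sym2 ℕ) (i j : Fin n) : adjMatrix τ i j = -adjMatrix τ j i := by
  simp [adjMatrix]

theorem edgeInd_nonneg (e p : Sym2 ℕ) : 0 ≤ edgeInd e p := by
  unfold edgeInd; split_ifs <;> simp

theorem ite_eq_edgeInd_add {e e' p : Sym2 ℕ} (hne : e ≠ e') [Decidable (p = e ∨ p = e')] :
    (if p = e ∨ p = e' then (1 : ℤ) else 0) = edgeInd e p + edgeInd e' p := by
  unfold edgeInd
  grind

theorem followsInd_insert {E : Set (Sym2 ℕ)} {e : Sym2 ℕ} (he : e ∉ E) (p q : Sym2 ℕ) :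
    followsInd (insert e E) p q = followsInd {e} p q + followsInd E p q := by
  have hexcl : IsTriangle p q e → ¬∃ r ∈ E, IsTriangle p q r := by
    rintro h ⟨r, hr, h'⟩
    exact he (h.eq h' ▸ hr)
  simp only [followsInd, Set.exists_mem_insert, Set.mem_singleton_iff, exists_eq_left]
  split_ifs <;> simp_all

namespace IsQuad

variable {τ : Fin n → Sym2 ℕ} {a b c d : ℕ} {p q : Sym2 ℕ} {k : Fin n}

theorem ne_and_ne (hq : IsQuad τ a b c d) : s(a, b) ≠ s(b, c) ∧ s(a, b) ≠ s(c, d) := by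
  have := hq.abc
  have := hq.cda
  simp only [Ne, Sym2.eq_iff]
  unfold Ccw at *; omega

theorem max_edgeInd_sub (hq : IsQuad τ a b c d) (p : Sym2 ℕ) :
    max (edgeInd s(b, c) p + edgeInd s(d, a) p - (edgeInd s(a, b) p + edgeInd s(c, d) p)) 0 =
      edgeInd s(b, c) p + edgeInd s(d, a) p := by
  have hdisj : edgeInd s(b, c) p + edgeInd s(d, a) p = 0 ∨
      edgeInd s(a, b) p + edgeInd s(c, d) p = 0 := by
    have hab := hq.ne_and_ne.1
    have hbc := hq.rotate.ne_and_ne.1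
    have hcd := hq.rotate.rotate.ne_and_ne.1
    have hda := hq.rotate.rotate.rotate.ne_and_ne.1
    unfold edgeInd
    grind
  have := edgeInd_nonneg s(a, b) p
  have := edgeInd_nonneg s(b, c) p
  have := edgeInd_nonneg s(c, d) p
  have := edgeInd_nonneg s(d, a) p
  omega

theorem isTriangle_iff (hq : IsQuad τ a b c d) (h : IsTriangulation τ) (hpe : p ∈ edges τ)
    (hqe : q ∈ edges τ) :
    IsTriangle p q s(a, c) ↔ p = s(a, b) ∧ q = s(b, c) ∨ p = s(c, d) ∧ q = s(d, a) := by
  constructor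
  · rintro ⟨x, y, z, hy, rfl, rfl, hac⟩
    obtain ⟨rfl, rfl⟩ | ⟨rfl, rfl⟩ := Sym2.eq_iff.1 hac
    · rw [h.apex_unique hy hpe hqe hq.cda hq.cd hq.da]
      exact .inr ⟨rfl, rfl⟩
    · rw [h.apex_unique hy hpe hqe hq.abc hq.ab hq.bc]
      exact .inl ⟨rfl, rfl⟩
  · rintro (⟨rfl, rfl⟩ | ⟨rfl, rfl⟩)
    · exact ⟨a, b, c, hq.abc, rfl, rfl, Sym2.eq_swap⟩
    · exact ⟨c, d, a, hq.cda, rfl, rfl, rfl⟩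

theorem followsInd_singleton (hq : IsQuad τ a b c d) (h : IsTriangulation τ) (hpe : p ∈ edges τ)
    (hqe : q ∈ edges τ) : followsInd {s(a, c)} p q =
      edgeInd s(a, b) p * edgeInd s(b, c) q + edgeInd s(c, d) p * edgeInd s(d, a) q := by
  simp only [followsInd, Set.mem_singleton_iff, exists_eq_left, hq.isTriangle_iff h hpe hqe,
    edgeInd]
  have := hq.ne_and_ne.2
  grind

theorem followsInd_left (hq : IsQuad τ a b c d) (h : IsTriangulation τ) (hpe : p ∈ edges τ) :
    followsInd (edges τ) p s(a, c) = edgeInd s(b, c) p + edgeInd s(d, a) p := by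
  classical
  rw [← ite_eq_edgeInd_add hq.rotate.ne_and_ne.2, followsInd]
  congr 1
  refine propext ⟨fun ⟨r, hr, hT⟩ => ?_, ?_⟩
  · exact ((hq.isTriangle_iff h hr hpe).1 hT.rotate.rotate).imp And.right And.right
  · rintro (rfl | rfl)
    · exact ⟨_, hq.ab, ((hq.isTriangle_iff h hq.ab hpe).2 (.inl ⟨rfl, rfl⟩)).rotate⟩
    · exact ⟨_, hq.cd, ((hq.isTriangle_iff h hq.cd hpe).2 (.inr ⟨rfl, rfl⟩)).rotate⟩

theorem followsInd_right (hq : IsQuad τ a b c d) (h : IsTriangulation τ) (hpe : p ∈ edges τ) :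
    followsInd (edges τ) s(a, c) p = edgeInd s(a, b) p + edgeInd s(c, d) p := by
  classical
  rw [← ite_eq_edgeInd_add hq.ne_and_ne.2, followsInd]
  congr 1
  refine propext ⟨fun ⟨r, hr, hT⟩ => ?_, ?_⟩
  · exact ((hq.isTriangle_iff h hpe hr).1 hT.rotate).imp And.left And.left
  · rintro (rfl | rfl)
    · exact ⟨_, hq.bc, ((hq.isTriangle_iff h hpe hq.bc).2 (.inl ⟨rfl, rfl⟩)).rotate.rotate⟩
    · exact ⟨_, hq.da, ((hq.isTriangle_iff h hpe hq.da).2 (.inr ⟨rfl, rfl⟩)).rotate.rotate⟩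

theorem adjMatrix_apply (hq : IsQuad τ a b c d) (h : IsTriangulation τ) (hk : τ k = s(a, c))
    (i : Fin n) : adjMatrix τ i k = edgeInd s(b, c) (τ i) + edgeInd s(d, a) (τ i) -
      (edgeInd s(a, b) (τ i) + edgeInd s(c, d) (τ i)) := by
  have hi := mem_edges_apply τ i
  rw [adjMatrix, Matrix.of_apply, hk, hq.followsInd_left h hi, hq.followsInd_right h hi]

theorem followsInd_flip (hq : IsQuad τ a b c d) (h : IsTriangulation τ) (hk : τ k = s(a, c))
    {i j : Fin n} (hi : i ≠ k) (hj : j ≠ k) :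
    followsInd (edges (Function.update τ k s(b, d))) (τ i) (τ j) +
        (edgeInd s(a, b) (τ i) * edgeInd s(b, c) (τ j) +
          edgeInd s(c, d) (τ i) * edgeInd s(d, a) (τ j)) =
      followsInd (edges τ) (τ i) (τ j) +
        (edgeInd s(b, c) (τ i) * edgeInd s(c, d) (τ j) +
          edgeInd s(d, a) (τ i) * edgeInd s(a, b) (τ j)) := by
  have hac : s(a, c) ∈ edges τ := hk ▸ mem_edges_apply τ k
  have hbd : s(b, d) ∉ edges τ \ {s(a, c)} := fun hbd => hq.notMem_edges h hk hbd.1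
  have mem : ∀ {i}, i ≠ k → τ i ∈ edges (Function.update τ k s(b, d)) := fun {i} hi =>
    .inr ⟨i, Function.update_of_ne hi ..⟩
  rw [← hq.followsInd_singleton h (mem_edges_apply τ i) (mem_edges_apply τ j),
    ← (hq.isQuad_flip h hk).followsInd_singleton (hq.isTriangulation_flip h hk) (mem hi) (mem hj),
    edges_flip hk h, followsInd_insert hbd]
  nth_rw 2 [← Set.insert_sdiff_self_of_mem hac]
  rw [followsInd_insert fun h => h.2 rfl]
  ring

theorem adjMatrix_flip (hq : IsQuad τ a b c d) (h : IsTriangulation τ) (hk : τ k = s(a, c)) :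
    adjMatrix (Function.update τ k s(b, d)) = mutateMatrix k (adjMatrix τ) := by
  have hcol : ∀ i, adjMatrix (Function.update τ k s(b, d)) i k = -adjMatrix τ i k := fun i => by
    rcases eq_or_ne i k with rfl | hi
    · simp [adjMatrix]
    · rw [(hq.isQuad_flip h hk).adjMatrix_apply (hq.isTriangulation_flip h hk)
        (Function.update_self ..), hq.adjMatrix_apply h hk, Function.update_of_ne hi]
      ring
  ext i j
  rw [mutateMatrix, Matrix.of_apply]
  split_ifs with hij
  · rcases hij with rfl | rfl
    · rw [adjMatrix_neg, hcol, adjMatrix_neg τ i j]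
    · exact hcol i
  · push Not at hij
    have hflip := hq.followsInd_flip h hk hij.1 hij.2
    have hflip' := hq.followsInd_flip h hk hij.2 hij.1
    rw [adjMatrix_neg τ k j, neg_neg, hq.adjMatrix_apply h hk, hq.adjMatrix_apply h hk,
      hq.max_edgeInd_sub, hq.max_edgeInd_sub]
    simp only [adjMatrix, Matrix.of_apply, Function.update_of_ne hij.1,
      Function.update_of_ne hij.2]
    linear_combination hflip - hflip'

end IsQuad

end AdjacencyMatrix

section TriangulationSeed

variable {n : ℕ} {F : Type*} [Field F]

/-- The determinant of two vectors in the plane. -/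
def det₂ (p q : F × F) : F := p.1 * q.2 - p.2 * q.1

/-- The length of the segment `e` of a polygon with a vector `v a` attached to each vertex `a`: the
determinant of the vectors at its end points, the one with the smaller number first. Like the
lengths of the chords of a circle, these satisfy Ptolemy's relation. -/
def length (v : ℕ → F × F) (e : Sym2 ℕ) : F := det₂ (v e.inf) (v e.sup)

theorem length_mk_of_le (v : ℕ → F × F) {a b : ℕ} (hab : a ≤ b) :
    length v s(a, b) = det₂ (v a) (v b) := by
  simp [length, hab]

theorem length_mul_length (v : ℕ → F × F) {a b c d : ℕ} (hb : Ccw a b c) (hd : Ccw c d a) :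
    length v s(a, c) * length v s(b, d) =
      length v s(a, b) * length v s(c, d) + length v s(b, c) * length v s(d, a) := by
  have ptolemy : ∀ {a b c d : ℕ}, a < b → b < c → c < d →
      length v s(a, c) * length v s(b, d) =
        length v s(a, b) * length v s(c, d) + length v s(b, c) * length v s(d, a) := by
    intro a b c d hab hbc hcd
    rw [length_mk_of_le v (by omega), length_mk_of_le v (by omega), length_mk_of_le v (by omega),
      length_mk_of_le v (by omega), length_mk_of_le v (by omega), Sym2.eq_swap (a := d),
      length_mk_of_le v (by omega)]
    unfold det₂
    ring
  obtain ⟨h₁, h₂, h₃⟩ | ⟨h₁, h₂, h₃⟩ | ⟨h₁, h₂, h₃⟩ | ⟨h₁, h₂, h₃⟩ :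
      (a < b ∧ b < c ∧ c < d) ∨ (b < c ∧ c < d ∧ d < a) ∨ (c < d ∧ d < a ∧ a < b) ∨
        (d < a ∧ a < b ∧ b < c) := by
    unfold Ccw at hb hd; omega
  · exact ptolemy h₁ h₂ h₃
  · have := ptolemy h₁ h₂ h₃
    rw [Sym2.eq_swap (a := c) (b := a)] at this
    linear_combination this
  · have := ptolemy h₁ h₂ h₃
    rw [Sym2.eq_swap (a := c) (b := a), Sym2.eq_swap (a := d) (b := b)] at this
    linear_combination this
  · have := ptolemy h₁ h₂ h₃
    rw [Sym2.eq_swap (a := d) (b := b)] at this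
    linear_combination this

/-- `S` is the seed of the triangulation `τ` of the polygon with vectors `v` attached to its
vertices and sides of length one: its cluster variables are the lengths of the diagonals. -/
structure IsTriangulationSeed (v : ℕ → F × F) (τ : Fin n → Sym2 ℕ) (S : Seed n F) : Prop where
  isTriangulation : IsTriangulation τ
  length_side : ∀ e ∈ sides n, length v e = 1
  cluster_eq : ∀ i, S.cluster i = length v (τ i)
  matrix_eq : S.matrix = adjMatrix τ

namespace IsTriangulationSeed

variable {v : ℕ → F × F} {τ : Fin n → Sym2 ℕ} {S : Seed n F}

theorem prod_zpow_edgeInd (h : IsTriangulationSeed v τ S) {e : Sym2 ℕ} (he : e ∈ edges τ) :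
    ∏ j, S.cluster j ^ edgeInd e (τ j) = length v e := by
  by_cases hi : ∃ i, τ i = e
  · obtain ⟨i, rfl⟩ := hi
    rw [Finset.prod_eq_single i]
    · simp [edgeInd, h.cluster_eq]
    · intro j _ hj
      simp [edgeInd, h.isTriangulation.injective.ne hj]
    · simp
  · rw [h.length_side e (he.resolve_right hi)]
    refine Finset.prod_eq_one fun j _ => ?_
    have hj : τ j ≠ e := fun hj => hi ⟨j, hj⟩
    simp [edgeInd, hj]

theorem prod_zpow_edgeInd_add (h : IsTriangulationSeed v τ S) (h0 : ∀ i, S.cluster i ≠ 0)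
    {e e' : Sym2 ℕ} (he : e ∈ edges τ) (he' : e' ∈ edges τ) :
    ∏ j, S.cluster j ^ (edgeInd e (τ j) + edgeInd e' (τ j)) = length v e * length v e' := by
  simp only [zpow_add₀ (h0 _), Finset.prod_mul_distrib]
  rw [h.prod_zpow_edgeInd he, h.prod_zpow_edgeInd he']

theorem exists_mutate (h : IsTriangulationSeed v τ S) (h0 : ∀ i, S.cluster i ≠ 0) (k : Fin n) :
    ∃ τ', IsTriangulationSeed v τ' (S.mutate k) := by
  obtain ⟨a, b, c, d, hk, hq⟩ := h.isTriangulation.exists_isQuad k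
  refine ⟨_, hq.isTriangulation_flip h.isTriangulation hk, h.length_side, fun i => ?_, ?_⟩
  · rcases eq_or_ne i k with rfl | hi
    · have hmax : ∀ p, max (edgeInd s(a, b) p + edgeInd s(c, d) p -
          (edgeInd s(b, c) p + edgeInd s(d, a) p)) 0 =
            edgeInd s(a, b) p + edgeInd s(c, d) p := fun p => by
        have := hq.rotate.max_edgeInd_sub p
        rwa [add_comm (edgeInd s(c, d) p)] at this
      rw [Seed.mutate_cluster_self, Function.update_self, h.matrix_eq]
      simp only [hq.adjMatrix_apply h.isTriangulation hk, neg_sub, hq.max_edgeInd_sub, hmax]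
      rw [h.prod_zpow_edgeInd_add h0 hq.bc hq.da, h.prod_zpow_edgeInd_add h0 hq.ab hq.cd,
        inv_mul_eq_iff_eq_mul₀ (h0 i), h.cluster_eq, hk, length_mul_length v hq.abc hq.cda,
        add_comm]
    · rw [Seed.mutate_cluster_of_ne _ hi, Function.update_of_ne hi, h.cluster_eq]
  · rw [hq.adjMatrix_flip h.isTriangulation hk, ← h.matrix_eq]
    rfl

theorem exists_of_mutatesTo [CharZero F] {S' : Seed n F} (h : IsTriangulationSeed v τ S)
    (hS : S.IsLabeledSeed) (hSS' : S.MutatesTo S') : ∃ τ', IsTriangulationSeed v τ' S' := by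
  induction hSS' with
  | refl => exact ⟨τ, h⟩
  | tail hT hk ih =>
    obtain ⟨k, rfl⟩ := hk
    obtain ⟨τ', h'⟩ := ih
    exact h'.exists_mutate (hS.of_mutatesTo hT).cluster_ne_zero k

end IsTriangulationSeed

end TriangulationSeed

section InitialSeed

variable {n : ℕ} {F : Type*} [Field F]

theorem det₂_swap (p q : F × F) : -det₂ p q = det₂ q p := by
  unfold det₂
  ring

theorem exists_det₂_eq {p q : F × F} (h : det₂ p q ≠ 0) (α β : F) :
    ∃ w, det₂ p w = α ∧ det₂ q w = β := by
  refine ⟨(det₂ p q)⁻¹ • (α • q - β • p), mul_left_cancel₀ h ?_, mul_left_cancel₀ h ?_⟩ <;>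
    simp only [det₂, Prod.smul_fst, Prod.smul_snd, Prod.fst_sub, Prod.snd_sub, smul_eq_mul]
      at h ⊢ <;>
    field_simp <;> ring

/-- The numbers `l i` are the left ends of nested intervals `[l i, l i + i + 2]`, the last of which
is `[0, n + 2]`. -/
def IsNested (n : ℕ) (l : ℕ → ℕ) : Prop :=
  l n = 0 ∧ ∀ i < n, l i = l (i + 1) ∨ l i = l (i + 1) + 1

theorem exists_isNested (n : ℕ) (P : ℕ → Prop) :
    ∃ l, IsNested n l ∧ ∀ i < n, l i = l (i + 1) + 1 ↔ P i := by
  classical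
  let l : ℕ → ℕ := fun i => ∑ j ∈ Finset.Ico i n, if P j then 1 else 0
  have hl : ∀ i < n, l i = (if P i then 1 else 0) + l (i + 1) := fun i hi =>
    Finset.sum_eq_sum_Ico_succ_bot hi _
  refine ⟨l, ⟨by simp [l], fun i hi => ?_⟩, fun i hi => ?_⟩ <;>
    · have := hl i hi
      split_ifs at this <;> simp_all; omega

/-- The segment joining the ends of the interval `[l i, l i + i + 2]`. -/
def nestedChord (l : ℕ → ℕ) (i : ℕ) : Sym2 ℕ := s(l i, l i + i + 2)

/-- The triangulation by the first `n` nested chords, the chord number `i` having the label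
`σ i`. -/
def nestedDiagonals (l : ℕ → ℕ) (σ : Equiv.Perm (Fin n)) (j : Fin n) : Sym2 ℕ :=
  nestedChord l (σ.symm j)

namespace IsNested

variable {l : ℕ → ℕ} (h : IsNested n l)
include h

theorem mono {i j : ℕ} (hij : i ≤ j) (hj : j ≤ n) : l j ≤ l i ∧ l i + i ≤ l j + j := by
  induction j, hij using Nat.le_induction with
  | base => omega
  | succ j _ ih =>
    have := ih (by omega)
    have := h.2 j (by omega)
    omega

theorem exists_extension (v : ℕ → F × F) {k : ℕ} (hk : k < n)
    (hv : det₂ (v (l k)) (v (l k + k + 2)) ≠ 0) (α : F) :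
    ∃ v' : ℕ → F × F, (∀ a, l k ≤ a → a ≤ l k + k + 2 → v' a = v a) ∧
      (∀ a, l (k + 1) ≤ a → a < l (k + 1) + (k + 1) + 2 → ¬(l k ≤ a ∧ a < l k + k + 2) →
        det₂ (v' a) (v' (a + 1)) = 1) ∧
      det₂ (v' (l (k + 1))) (v' (l (k + 1) + (k + 1) + 2)) = α := by
  rcases h.2 k hk with hl | hl
  · obtain ⟨w, hα, h1⟩ := exists_det₂_eq hv α 1
    refine ⟨Function.update v (l k + k + 3) w, fun a _ _ => Function.update_of_ne (by omega) ..,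
      fun a _ _ _ => ?_, ?_⟩
    · obtain rfl : a = l k + k + 2 := by omega
      rwa [Function.update_self, Function.update_of_ne (by omega)]
    · rwa [← hl, ← add_assoc, add_right_comm _ 1, Function.update_self,
        Function.update_of_ne (by omega)]
  · obtain ⟨w, h1, hα⟩ := exists_det₂_eq hv (-1) (-α)
    refine ⟨Function.update v (l (k + 1)) w, fun a _ _ => Function.update_of_ne (by omega) ..,
      fun a _ _ _ => ?_, ?_⟩
    · obtain rfl : a = l (k + 1) := by omega
      rw [Function.update_self, Function.update_of_ne (by omega), ← hl, ← det₂_swap, h1, neg_neg]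
    · rw [show l (k + 1) + (k + 1) + 2 = l k + k + 2 by omega, Function.update_self,
        Function.update_of_ne (by omega), ← det₂_swap, hα, neg_neg]

theorem exists_det₂_chord_eq {x : ℕ → F} (hx : ∀ i < n, x i ≠ 0) {k : ℕ} (hk : k ≤ n) :
    ∃ v : ℕ → F × F, (∀ a, l k ≤ a → a < l k + k + 2 → det₂ (v a) (v (a + 1)) = 1) ∧
      ∀ i ≤ k, det₂ (v (l i)) (v (l i + i + 2)) = x i := by
  induction k with
  | zero =>
    refine ⟨fun a => if a = l 0 then (1, 0) else if a = l 0 + 1 then (0, 1) else (-1, x 0),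
      fun a _ _ => ?_, fun i hi => ?_⟩
    · obtain rfl | rfl : a = l 0 ∨ a = l 0 + 1 := by omega
      · simp [det₂]
      · simp [det₂, show l 0 + 1 + 1 ≠ l 0 by omega]
    · obtain rfl : i = 0 := by omega
      simp [det₂]
  | succ k ih =>
    obtain ⟨v, hside, hchord⟩ := ih (by omega)
    obtain ⟨v', hvv', hside', hchord'⟩ :=
      h.exists_extension v hk (hchord k le_rfl ▸ hx k hk) (x (k + 1))
    refine ⟨v', fun a h1 h2 => ?_, fun i hi => ?_⟩
    · by_cases ha : l k ≤ a ∧ a < l k + k + 2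
      · rw [hvv' a (by omega) (by omega), hvv' (a + 1) (by omega) (by omega)]
        exact hside a ha.1 ha.2
      · exact hside' a h1 h2 ha
    · rcases hi.lt_or_eq with hi | rfl
      · have := h.mono (Nat.lt_succ_iff.1 hi) (by omega)
        rw [hvv' _ (by omega) (by omega), hvv' _ (by omega) (by omega)]
        exact hchord i (by omega)
      · exact hchord'

omit h in
theorem mem_edges_nestedDiagonals {i : ℕ} (hi : i < n) (l : ℕ → ℕ) (σ : Equiv.Perm (Fin n)) :
    nestedChord l i ∈ edges (nestedDiagonals l σ) :=
  .inr ⟨σ ⟨i, hi⟩, by simp [nestedDiagonals]⟩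

theorem not_crosses {i j : ℕ} (hi : i ≤ n) (hj : j ≤ n) :
    ¬Crosses (nestedChord l i) (nestedChord l j) := by
  wlog hij : i ≤ j generalizing i j
  · exact fun hc => this hj hi (by omega) hc.symm
  rw [nestedChord, nestedChord, crosses_mk]
  have := h.mono hij hj
  unfold Ccw
  omega

theorem eq_or_of_not_crosses {a b k : ℕ} (hk : k ≤ n) (ha : l k ≤ a) (hab : a < b)
    (hb : b ≤ l k + k + 2) (hc : ∀ i < n, ¬Crosses (nestedChord l i) s(a, b)) :
    b = a + 1 ∨ ∃ i ≤ k, s(a, b) = nestedChord l i := by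
  induction k with
  | zero =>
    by_cases hba : b = a + 1
    · exact .inl hba
    · exact .inr ⟨0, le_rfl, by rw [nestedChord, Sym2.eq_iff]; omega⟩
  | succ k ih =>
    by_cases hk' : l k ≤ a ∧ b ≤ l k + k + 2
    · exact (ih (by omega) hk'.1 hk'.2).imp_right fun ⟨i, hi, hib⟩ => ⟨i, by omega, hib⟩
    · have hck := hc k (by omega)
      have hl := h.2 k (by omega)
      by_cases hba : b = a + 1
      · exact .inl hba
      · refine .inr ⟨k + 1, le_rfl, ?_⟩
        rw [nestedChord, crosses_mk] at hck
        rw [nestedChord, Sym2.eq_iff]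
        unfold Ccw at hck
        omega

theorem nestedDiagonals_mem_diagonals (σ : Equiv.Perm (Fin n)) (k : Fin n) :
    nestedDiagonals l σ k ∈ diagonals n := by
  have := h.mono (σ.symm k).2.le le_rfl
  have := h.1
  rw [nestedDiagonals, nestedChord, mk_mem_diagonals, mk_mem_sides]
  omega

theorem isTriangulation (σ : Equiv.Perm (Fin n)) : IsTriangulation (nestedDiagonals l σ) where
  injective i j hij := by
    rw [nestedDiagonals, nestedDiagonals, nestedChord, nestedChord, Sym2.eq_iff] at hij
    exact σ.symm.injective (Fin.ext (by omega))
  mem_diagonals := h.nestedDiagonals_mem_diagonals σ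
  noncrossing e he f hf := by
    have hle := fun {e} => le_of_mem_edges (e := e) (h.nestedDiagonals_mem_diagonals σ)
    rcases he with he | ⟨i, rfl⟩
    · exact not_crosses_of_mem_sides he (hle hf)
    rcases hf with hf | ⟨j, rfl⟩
    · exact fun hc => not_crosses_of_mem_sides hf (hle (mem_edges_apply _ i)) hc.symm
    · exact h.not_crosses (σ.symm i).2.le (σ.symm j).2.le
  maximal e hdiag hle hc := by
    obtain ⟨a, b, rfl, hab⟩ : ∃ a b, e = s(a, b) ∧ a < b := by
      induction e with | _ a b =>
      rcases Nat.lt_or_gt_of_ne (Sym2.mk_isDiag_iff.not.1 hdiag) with hab | hab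
      · exact ⟨a, b, rfl, hab⟩
      · exact ⟨b, a, Sym2.eq_swap, hab⟩
    have hb := hle b (Sym2.mem_mk_right a b)
    have hl := h.1
    obtain rfl | ⟨i, hi, hib⟩ := h.eq_or_of_not_crosses le_rfl (by omega) hab (by omega)
      fun i hi hcross => hc _ (mem_edges_nestedDiagonals hi l σ) hcross.symm
    · exact .inl (mk_mem_sides.2 (by omega))
    · rw [hib]
      rcases hi.lt_or_eq with hi | rfl
      · exact mem_edges_nestedDiagonals hi l σ
      · exact .inl (mk_mem_sides.2 (by omega))

theorem mono_or {i j : ℕ} (hi : i ≤ n) (hj : j ≤ n) :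
    l j ≤ l i ∧ l i + i ≤ l j + j ∨ l i ≤ l j ∧ l j + j ≤ l i + i :=
  (le_total i j).imp (h.mono · hj) (h.mono · hi)

theorem mem_sides_of_isTriangle (σ : Equiv.Perm (Fin n)) {i j : ℕ} (hi : i < n) (hj : j < n)
    {r : Sym2 ℕ} (hr : r ∈ edges (nestedDiagonals l σ))
    (hT : IsTriangle (nestedChord l i) (nestedChord l j) r) : r ∈ sides n := by
  obtain hr | ⟨k, rfl⟩ := hr
  · exact hr
  obtain ⟨x, y, z, hxyz, hx, hy, hz⟩ := hT
  have hij := h.mono_or hi.le hj.le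
  have hjk := h.mono_or hj.le (σ.symm k).2.le
  have hki := h.mono_or (σ.symm k).2.le hi.le
  simp only [nestedDiagonals, nestedChord, Sym2.eq_iff] at hx hy hz
  unfold Ccw at hxyz
  omega

theorem exists_isTriangle_iff (σ : Equiv.Perm (Fin n)) {i j : ℕ} (hi : i < n) (hj : j < n) :
    (∃ r ∈ edges (nestedDiagonals l σ), IsTriangle (nestedChord l i) (nestedChord l j) r) ↔
      j = i + 1 ∧ l i = l j + 1 ∨ i = j + 1 ∧ l j = l i := by
  have hli := h.mono hi.le le_rfl
  have hlj := h.mono hj.le le_rfl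
  have hn := h.1
  constructor
  · rintro ⟨r, hr, hT⟩
    have hside := h.mem_sides_of_isTriangle σ hi hj hr hT
    obtain ⟨x, y, z, hxyz, hx, hy, rfl⟩ := hT
    have hij := h.mono_or hi.le hj.le
    rw [nestedChord, Sym2.eq_iff] at hx hy
    rw [mk_mem_sides] at hside
    unfold Ccw at hxyz
    omega
  · rintro (⟨rfl, hl⟩ | ⟨rfl, hl⟩)
    · refine ⟨s(l (i + 1), l i), .inl (mk_mem_sides.2 (by omega)), l i, l i + i + 2, l (i + 1),
        ?_, rfl, ?_, rfl⟩
      · unfold Ccw; omega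
      · rw [nestedChord, Sym2.eq_iff]; omega
    · refine ⟨s(l j + j + 2, l j + j + 3), .inl (mk_mem_sides.2 (by omega)), l j + j + 3, l j,
        l j + j + 2, ?_, ?_, rfl, rfl⟩
      · unfold Ccw; omega
      · rw [nestedChord, Sym2.eq_iff]; omega

theorem adjMatrix_nestedDiagonals (σ : Equiv.Perm (Fin n)) (i j : Fin n) :
    adjMatrix (nestedDiagonals l σ) (σ i) (σ j) =
      (if (j : ℕ) = i + 1 ∧ l i = l j + 1 ∨ (i : ℕ) = j + 1 ∧ l j = l i then 1 else 0) -
        (if (i : ℕ) = j + 1 ∧ l j = l i + 1 ∨ (j : ℕ) = i + 1 ∧ l i = l j then 1 else 0) := by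
  have hij := h.exists_isTriangle_iff σ i.2 j.2
  have hji := h.exists_isTriangle_iff σ j.2 i.2
  simp [adjMatrix, followsInd, nestedDiagonals, hij, hji]

theorem eq_adjMatrix {B : Matrix (Fin n) (Fin n) ℤ} (σ : Equiv.Perm (Fin n))
    (hB : ∀ i j, B (σ j) (σ i) = -B (σ i) (σ j))
    (hadj : ∀ i j : Fin n, (i : ℕ) + 1 = j →
      B (σ i) (σ j) = if l i = l (i + 1) + 1 then 1 else -1)
    (hzero : ∀ i j : Fin n, ¬((i : ℕ) + 1 = j ∨ (j : ℕ) + 1 = i) → B (σ i) (σ j) = 0) :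
    B = adjMatrix (nestedDiagonals l σ) := by
  have hsucc : ∀ i j : Fin n, (i : ℕ) + 1 = j →
      B (σ i) (σ j) = adjMatrix (nestedDiagonals l σ) (σ i) (σ j) := fun i j hij => by
    have := h.2 i i.2
    rw [hadj i j hij, h.adjMatrix_nestedDiagonals, ← hij]
    split_ifs <;> omega
  ext i' j'
  obtain ⟨i, rfl⟩ := σ.surjective i'
  obtain ⟨j, rfl⟩ := σ.surjective j'
  by_cases hij : (i : ℕ) + 1 = j
  · exact hsucc i j hij
  · by_cases hji : (j : ℕ) + 1 = i
    · rw [hB j i, hsucc j i hji, ← adjMatrix_neg]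
    · rw [hzero i j (by omega), h.adjMatrix_nestedDiagonals]
      split_ifs <;> omega

end IsNested

theorem IsSkewSymmetrizable.apply_swap_of_abs_eq {B : Matrix (Fin n) (Fin n) ℤ}
    (hB : IsSkewSymmetrizable B) {i j : Fin n} (habs : |B i j| = |B j i|) : B j i = -B i j := by
  obtain ⟨d, hd, hs⟩ := isSkewSymmetrizable_iff.1 hB
  rcases abs_eq_abs.1 habs with hij | hij
  · have hzero : (d i + d j) * B i j = 0 := by
      have := hs i j
      rw [← hij] at this
      linear_combination this
    have := (mul_eq_zero.1 hzero).resolve_left (add_pos (hd i) (hd j)).ne'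
    rw [← hij, this, neg_zero]
  · rw [hij, neg_neg]

theorem abs_apply_of_submatrix_eq_A {B : Matrix (Fin n) (Fin n) ℤ} {σ : Equiv.Perm (Fin n)}
    (hσ : (cartanCounterpart B).submatrix σ σ = CartanMatrix.A n) {i j : Fin n} (hij : i ≠ j) :
    |B (σ i) (σ j)| = if (i : ℕ) + 1 = j ∨ (j : ℕ) + 1 = i then 1 else 0 := by
  have := congrFun (congrFun hσ i) j
  simp only [cartanCounterpart, Matrix.submatrix_apply, Matrix.of_apply, σ.injective.ne hij,
    if_false, CartanMatrix.A, hij] at this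
  split_ifs at this ⊢ <;> simpa using this

theorem exists_isNested_matrix_eq {B : Matrix (Fin n) (Fin n) ℤ} (hB : IsSkewSymmetrizable B)
    (hA : IsCartanOfTypeA (cartanCounterpart B)) :
    ∃ l, IsNested n l ∧ ∃ σ : Equiv.Perm (Fin n), B = adjMatrix (nestedDiagonals l σ) := by
  obtain ⟨σ, hσ⟩ := hA
  have hdiag := hB.diag_eq_zero
  have habs := fun {i j} => abs_apply_of_submatrix_eq_A hσ (i := i) (j := j)
  obtain ⟨l, hl, hlB⟩ := exists_isNested n fun i =>
    ∃ (hi : i < n) (hi' : i + 1 < n), B (σ ⟨i, hi⟩) (σ ⟨i + 1, hi'⟩) = 1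
  refine ⟨l, hl, σ, hl.eq_adjMatrix σ (fun i j => ?_) (fun i j hij => ?_) fun i j hij => ?_⟩
  · rcases eq_or_ne i j with rfl | hij
    · simp [hdiag]
    · exact hB.apply_swap_of_abs_eq (by simp only [habs hij, habs hij.symm, or_comm])
  · obtain ⟨j, hj⟩ := j
    obtain rfl : (i : ℕ) + 1 = j := hij
    have hone := habs (Fin.ne_of_lt (Fin.lt_def.2 (Nat.lt_succ_self i)) : i ≠ ⟨i + 1, hj⟩)
    rw [if_pos (.inl rfl)] at hone
    split_ifs with hli
    · obtain ⟨_, _, h⟩ := (hlB i i.2).1 hli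
      exact h
    · exact (eq_or_eq_neg_of_abs_eq hone).resolve_left
        fun h => hli ((hlB i i.2).2 ⟨i.2, hj, h⟩)
  · rcases eq_or_ne i j with rfl | hne
    · exact hdiag _
    · rw [← abs_eq_zero, habs hne, if_neg hij]

theorem exists_isTriangulationSeed [CharZero F] {S : Seed n F} (hS : S.IsLabeledSeed)
    (hA : IsCartanOfTypeA (cartanCounterpart S.matrix)) :
    ∃ v τ, IsTriangulationSeed v τ S := by
  obtain ⟨l, hl, σ, hσ⟩ := exists_isNested_matrix_eq hS.2.2 hA
  let x (i : ℕ) : F := if hi : i < n then S.cluster (σ ⟨i, hi⟩) else 1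
  have hx : ∀ i < n, x i ≠ 0 := fun i hi => by
    simp only [x, hi, dif_pos]
    exact hS.cluster_ne_zero _
  obtain ⟨v, hside, hchord⟩ := hl.exists_det₂_chord_eq hx le_rfl
  refine ⟨v, nestedDiagonals l σ, hl.isTriangulation σ, ?_, fun i => ?_, hσ⟩
  · rintro e (⟨a, ha, rfl⟩ | rfl)
    · rw [length_mk_of_le v a.le_succ]
      exact hside a (by rw [hl.1]; omega) (by omega)
    · have := hchord n le_rfl
      rw [hl.1, zero_add] at this
      rw [length_mk_of_le v (Nat.zero_le _), this]
      simp [x]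
  · rw [nestedDiagonals, nestedChord, length_mk_of_le v (by omega),
      hchord (σ.symm i) (σ.symm i).2.le]
    simp [x]

end InitialSeed

section LaurentExpansion

variable {n : ℕ} {F : Type*} [Field F]

/-- The elements `A`, `B` of the field have Laurent expansions as in `HalfExpansion`. -/
def HasHalfExpansion (x : Fin n → F) (k : Fin n) (s r : Set (Fin n)) (A B : F) : Prop :=
  ∃ U W, HalfExpansion k s r U W ∧ MvLaurent.eval x U = A ∧ MvLaurent.eval x W = B

namespace HasHalfExpansion

variable {x : Fin n → F} {k : Fin n} {s r : Set (Fin n)} {A B : F}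

theorem swap (h : HasHalfExpansion x k s r A B) : HasHalfExpansion x k s r B A :=
  let ⟨U, W, h, hU, hW⟩ := h
  ⟨W, U, h.swap, hW, hU⟩

theorem cross (hx : ∀ j, x j ≠ 0) (h : HasHalfExpansion x k s r A B) {k' : Fin n}
    {s' : Set (Fin n)} {c : Fin n → ℤ} (hs : IsEnlargement k s k' s' c) (hkr : k ∈ r) {A' : F}
    (hA' : x k * A' = A * x k' + B * ∏ j, x j ^ c j) : HasHalfExpansion x k' s' r A' B := by
  obtain ⟨U, W, hUW, rfl, rfl⟩ := h
  refine ⟨_, W, hUW.cross hs hkr, ?_, rfl⟩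
  rw [MvLaurent.cross, MvLaurent.eval_mul hx, MvLaurent.eval_add hx, MvLaurent.eval_mul hx,
    MvLaurent.eval_mul hx, MvLaurent.eval_monomial_single, MvLaurent.eval_monomial_single,
    MvLaurent.eval_monomial, zpow_one, ← hA', zpow_neg_one, mul_comm, inv_mul_cancel_left₀ (hx k)]

theorem exists_isPatterned (hx : ∀ j, x j ≠ 0) (h : HasHalfExpansion x k s r A B)
    {s' : Set (Fin n)} {A' B' C : F} (h' : HasHalfExpansion x k s' r A' B') (hd : Disjoint s s')
    (hkr : k ∈ r) (hC : x k * C = A * B' + B * A') :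
    ∃ f : MvLaurent n ℤ, MvLaurent.eval x f = C ∧ (∀ m, 0 ≤ f.coeff m) ∧ IsPatterned f k ∧
      ∀ j ∉ r, IsPatterned f j := by
  obtain ⟨U, W, hUW, rfl, rfl⟩ := h
  obtain ⟨U', W', hUW', rfl, rfl⟩ := h'
  refine ⟨MvLaurent.glue k U W U' W', ?_, hUW.coeff_glue_nonneg hUW' hd,
    hUW.isPatterned_glue hUW' hd,
    fun j hj => .of_exponent fun m hm => hUW.exponent_glue hUW' hd hkr hm hj⟩
  rw [MvLaurent.glue, MvLaurent.eval_mul hx, MvLaurent.eval_add hx, MvLaurent.eval_mul hx,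
    MvLaurent.eval_mul hx, MvLaurent.eval_monomial_single, ← hC, zpow_neg_one, mul_comm,
    inv_mul_cancel_left₀ (hx k)]

end HasHalfExpansion

/-- The exponent vector of the length of an edge of the triangulation `τ`: zero for a side of the
polygon. -/
def edgeExponent (τ : Fin n → Sym2 ℕ) (e : Sym2 ℕ) : Fin n → ℤ := fun j => edgeInd e (τ j)

theorem isVarExponent_edgeExponent {τ : Fin n → Sym2 ℕ} (hτ : Function.Injective τ) {e : Sym2 ℕ}
    {t : Set (Fin n)} (ht : ∀ j, τ j = e → j ∈ t) : IsVarExponent t (edgeExponent τ e) := by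
  by_cases he : ∃ j, τ j = e
  · obtain ⟨i, rfl⟩ := he
    refine .inr ⟨i, ht i rfl, funext fun j => ?_⟩
    simp only [edgeExponent, edgeInd, Pi.single_apply, hτ.eq_iff]
  · rw [not_exists] at he
    exact .inl (funext fun j => if_neg (he j))

section SideDiagonals

/-- The diagonals of the triangulation `τ`, other than `s(u, w)` itself, on that side of `s(u, w)`
which contains the vertices met on the way from `u` to `w`. -/
def sideDiagonals (τ : Fin n → Sym2 ℕ) (u w : ℕ) : Set (Fin n) :=
  {j | τ j ≠ s(u, w) ∧ ∀ x ∈ τ j, ¬Ccw w x u}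

variable {τ : Fin n → Sym2 ℕ} {u w z : ℕ} {i k : Fin n}

theorem mem_sideDiagonals_iff {j : Fin n} {x y : ℕ} (hj : τ j = s(x, y)) :
    j ∈ sideDiagonals τ u w ↔
      ¬(x = u ∧ y = w ∨ x = w ∧ y = u) ∧ ¬Ccw w x u ∧ ¬Ccw w y u := by
  simp [sideDiagonals, hj]

theorem disjoint_sideDiagonals (hτ : ∀ j, τ j ∈ diagonals n) (huw : u ≠ w) :
    Disjoint (sideDiagonals τ u w) (sideDiagonals τ w u) := by
  refine Set.disjoint_left.2 fun j hj hj' => ?_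
  obtain ⟨x, y, hxy⟩ : ∃ x y, τ j = s(x, y) := Sym2.exists.1 ⟨τ j, rfl⟩
  have hne := (mk_mem_diagonals.1 (hxy ▸ hτ j)).1
  have hends : ∀ p ∈ τ j, p = u ∨ p = w := fun p hp => by
    have := hj.2 p hp
    have := hj'.2 p hp
    unfold Ccw at *; omega
  have hx := hends x (hxy ▸ Sym2.mem_mk_left x y)
  have hy := hends y (hxy ▸ Sym2.mem_mk_right x y)
  exact hj.1 (hxy.trans (Sym2.eq_iff.2 (by omega)))

theorem sideDiagonals_subset_left (hz : Ccw u z w) : sideDiagonals τ u z ⊆ sideDiagonals τ u w := by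
  intro j hj
  obtain ⟨x, y, hxy⟩ : ∃ x y, τ j = s(x, y) := Sym2.exists.1 ⟨τ j, rfl⟩
  rw [mem_sideDiagonals_iff hxy] at hj ⊢
  unfold Ccw at *; omega

theorem sideDiagonals_subset_right (hz : Ccw u z w) :
    sideDiagonals τ z w ⊆ sideDiagonals τ u w := by
  intro j hj
  obtain ⟨x, y, hxy⟩ : ∃ x y, τ j = s(x, y) := Sym2.exists.1 ⟨τ j, rfl⟩
  rw [mem_sideDiagonals_iff hxy] at hj ⊢
  unfold Ccw at *; omega

theorem isEnlargement_left (hτ : Function.Injective τ) (hz : Ccw u z w) (hi : τ i = s(u, z))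
    (hk : τ k = s(u, w)) : IsEnlargement i (sideDiagonals τ u z) k (sideDiagonals τ u w)
      (edgeExponent τ s(z, w)) where
  notMem hj := hj.1 hk
  subset := sideDiagonals_subset_left hz
  mem := by
    rw [mem_sideDiagonals_iff hi]
    unfold Ccw at *; omega
  isVarExponent := isVarExponent_edgeExponent hτ fun j hj => by
    have hji : j = i ↔ _ := hτ.eq_iff.symm
    simp only [Set.mem_ofPred_eq, mem_sideDiagonals_iff hj, Ne, hji, hi, hj, Sym2.eq_iff]
    unfold Ccw at *; omega

theorem isEnlargement_right (hτ : Function.Injective τ) (hz : Ccw u z w) (hi : τ i = s(z, w))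
    (hk : τ k = s(u, w)) : IsEnlargement i (sideDiagonals τ z w) k (sideDiagonals τ u w)
      (edgeExponent τ s(u, z)) where
  notMem hj := hj.1 hk
  subset := sideDiagonals_subset_right hz
  mem := by
    rw [mem_sideDiagonals_iff hi]
    unfold Ccw at *; omega
  isVarExponent := isVarExponent_edgeExponent hτ fun j hj => by
    have hji : j = i ↔ _ := hτ.eq_iff.symm
    simp only [Set.mem_ofPred_eq, mem_sideDiagonals_iff hj, Ne, hji, hi, hj, Sym2.eq_iff]
    unfold Ccw at *; omega

end SideDiagonals

namespace IsTriangulationSeed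

variable {v : ℕ → F × F} {τ : Fin n → Sym2 ℕ} {S : Seed n F} {a b u w : ℕ} {k : Fin n}

theorem eval_monomial_edgeExponent (h : IsTriangulationSeed v τ S) {e : Sym2 ℕ}
    (he : e ∈ edges τ) :
    MvLaurent.eval S.cluster (MvLaurent.monomial (edgeExponent τ e)) = length v e := by
  rw [MvLaurent.eval_monomial]
  exact h.prod_zpow_edgeInd he

theorem hasHalfExpansion_apex (h : IsTriangulationSeed v τ S) (r : Set (Fin n))
    (hk : τ k = s(u, w)) (ha : Ccw u a w) (hua : s(u, a) ∈ edges τ) (haw : s(a, w) ∈ edges τ) :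
    HasHalfExpansion S.cluster k (sideDiagonals τ u w) r (length v s(u, a)) (length v s(a, w)) := by
  have hinj := h.isTriangulation.injective
  refine ⟨_, _, .monomial r (fun hj => hj.1 hk) (isVarExponent_edgeExponent hinj fun j hj => ?_)
    (isVarExponent_edgeExponent hinj fun j hj => ?_), h.eval_monomial_edgeExponent hua,
    h.eval_monomial_edgeExponent haw⟩ <;>
  · rw [mem_sideDiagonals_iff hj]
    unfold Ccw at *; omega

theorem hasHalfExpansion (h : IsTriangulationSeed v τ S) (hx : ∀ j, S.cluster j ≠ 0)
    (hab : ∀ x ∈ s(a, b), x ≤ n + 2) (hk : τ k = s(u, w)) (ha : Ccw u a w) (hb : Ccw w b u) :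
    HasHalfExpansion S.cluster k (sideDiagonals τ u w) {j | Crosses (τ j) s(a, b)}
      (length v s(u, a)) (length v s(a, w)) := by
  induction hN : sideDiagonals τ u w using WellFoundedLT.induction generalizing u w k with
  | _ N ih =>
  subst hN
  have hinj := h.isTriangulation.injective
  obtain ⟨z, hz, huz, hzw⟩ :=
    h.isTriangulation.exists_apex (hk ▸ mem_edges_apply τ k) (hab a (Sym2.mem_mk_left a b)) ha
  obtain rfl | haz | hza := ha.eq_or_ccw_or_ccw z
  · exact h.hasHalfExpansion_apex _ hk ha huz hzw
  · have hbz := hz.rotate.trans_right hb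
    have hcross : Crosses s(u, z) s(a, b) := ⟨u, a, z, b, rfl, rfl, haz, hbz⟩
    obtain ⟨i, hi⟩ := exists_eq_of_crosses huz hab hcross
    have hir : Crosses (τ i) s(a, b) := hi ▸ hcross
    have hs := isEnlargement_left hinj hz hi hk
    have hlt : sideDiagonals τ u z < sideDiagonals τ u w :=
      ⟨hs.subset, fun hsub => (hsub hs.mem).1 hi⟩
    refine ((ih _ hlt hi haz hbz rfl).swap.cross hx hs hir ?_).swap
    simp only [edgeExponent]
    rw [h.prod_zpow_edgeInd hzw, h.cluster_eq, h.cluster_eq, hi, hk,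
      length_mul_length v haz hz.rotate, Sym2.eq_swap (a := w)]
    ring
  · have hbz := hb.trans_left hz.rotate.rotate
    have hcross : Crosses s(z, w) s(a, b) := ⟨z, a, w, b, rfl, rfl, hza, hbz⟩
    obtain ⟨i, hi⟩ := exists_eq_of_crosses hzw hab hcross
    have hir : Crosses (τ i) s(a, b) := hi ▸ hcross
    have hs := isEnlargement_right hinj hz hi hk
    have hlt : sideDiagonals τ z w < sideDiagonals τ u w :=
      ⟨hs.subset, fun hsub => (hsub hs.mem).1 hi⟩
    refine (ih _ hlt hi hza hbz rfl).cross hx hs hir ?_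
    simp only [edgeExponent]
    rw [h.prod_zpow_edgeInd huz, h.cluster_eq, h.cluster_eq, hi, hk,
      Sym2.eq_swap (a := u) (b := a), length_mul_length v hza hz.rotate.rotate,
      Sym2.eq_swap (a := w)]

theorem exists_expansion_of_crosses (h : IsTriangulationSeed v τ S) (hx : ∀ j, S.cluster j ≠ 0)
    {e : Sym2 ℕ} (he : ∀ x ∈ e, x ≤ n + 2) (hk : Crosses (τ k) e) :
    ∃ f : MvLaurent n ℤ, MvLaurent.eval S.cluster f = length v e ∧ (∀ m, 0 ≤ f.coeff m) ∧
      IsPatterned f k ∧ ∀ j, ¬Crosses (τ j) e → IsPatterned f j := by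
  obtain ⟨u, a, w, b, huw, rfl, ha, hb⟩ := hk
  have hinner := h.hasHalfExpansion hx he huw ha hb
  have houter := h.hasHalfExpansion hx (Sym2.eq_swap ▸ he) (huw.trans Sym2.eq_swap) hb ha
  rw [Sym2.eq_swap (a := b)] at houter
  have hne : u ≠ w := by unfold Ccw at ha; omega
  refine hinner.exists_isPatterned hx houter.swap
    (disjoint_sideDiagonals h.isTriangulation.mem_diagonals hne)
    ⟨u, a, w, b, huw, rfl, ha, hb⟩ ?_
  rw [h.cluster_eq, huw, length_mul_length v ha hb]

theorem exists_expansion [CharZero F] (h : IsTriangulationSeed v τ S)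
    (hS : AlgebraicIndependent ℚ S.cluster) {e : Sym2 ℕ} (hdiag : ¬e.IsDiag)
    (he : ∀ x ∈ e, x ≤ n + 2) :
    ∃ f : MvLaurent n ℤ, MvLaurent.eval S.cluster f = length v e ∧ (∀ m, 0 ≤ f.coeff m) ∧
      ∀ j, IsPatterned f j := by
  by_cases hmem : e ∈ edges τ
  · have hvar : IsVarExponent Set.univ (edgeExponent τ e) :=
      isVarExponent_edgeExponent h.isTriangulation.injective fun _ _ => Set.mem_univ _
    exact ⟨_, h.eval_monomial_edgeExponent hmem, MvLaurent.coeff_monomial_nonneg _, fun j =>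
      .of_exponent fun m hm => MvLaurent.coeff_monomial_ne_zero.1 hm ▸ hvar.apply j⟩
  · have hexp := fun k => h.exists_expansion_of_crosses hS.ne_zero he (k := k)
    obtain ⟨k, hk⟩ : ∃ k, Crosses (τ k) e := by
      by_contra! hcon
      refine hmem (h.isTriangulation.maximal e hdiag he fun f hf hef => ?_)
      obtain ⟨k, rfl⟩ := exists_eq_of_crosses hf he hef.symm
      exact hcon k hef.symm
    obtain ⟨f, hf, hnonneg, -, hfar⟩ := hexp k hk
    refine ⟨f, hf, hnonneg, fun j => ?_⟩
    by_cases hj : Crosses (τ j) e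
    · obtain ⟨g, hg, -, hgj, -⟩ := hexp j hj
      rwa [MvLaurent.eval_injective hS (hf.trans hg.symm)]
    · exact hfar j hj

end IsTriangulationSeed

end LaurentExpansion

/-- In the coefficient-free cluster algebra of type `A_n` of the cluster pattern through `S`, let
`S₀` be any seed (the initial one) and `S₁.cluster i` any cluster variable. Then there is exactly
one integer Laurent polynomial `f` expressing the cluster variable in the cluster of `S₀`; it is
log-concave, all its exponents are `-1`, `0` or `1`, and two nonzero coefficients at exponents `-1`
and `1` of a variable (the other exponents being equal) are both `1`, the one between being `2`. -/
theorem theorem4p2 (n : ℕ) {F : Type*} [Field F] [CharZero F]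
    (S : Seed n F) (hS : S.IsLabeledSeed) (hA : S.IsOfTypeA)
    (S₀ S₁ : Seed n F) (h₀ : S.MutatesTo S₀) (h₁ : S.MutatesTo S₁) (i : Fin n) :
    ∃ f : MvLaurent n ℤ,
      (∀ g : MvLaurent n ℤ, MvLaurent.eval S₀.cluster g = S₁.cluster i ↔ g = f) ∧
      MvLaurent.IsLogConcave f ∧
      (∀ m : Fin n → ℤ, f.coeff m ≠ 0 → ∀ j, m j = -1 ∨ m j = 0 ∨ m j = 1) ∧
      (∀ (j : Fin n) (m : Fin n → ℤ), m j = 0 →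
        f.coeff (m - Pi.single j 1) ≠ 0 → f.coeff (m + Pi.single j 1) ≠ 0 →
        f.coeff (m - Pi.single j 1) = 1 ∧ f.coeff (m + Pi.single j 1) = 1 ∧ f.coeff m = 2) := by
  obtain ⟨S', hS', hA⟩ := hA
  have hS₀ := hS.of_mutatesTo h₀
  have hS₁ := hS.of_mutatesTo h₁
  obtain ⟨v, τ', h'⟩ := exists_isTriangulationSeed (hS.of_mutatesTo hS') hA
  obtain ⟨τ, h⟩ := h'.exists_of_mutatesTo (hS.of_mutatesTo hS') (hS.mutatesTo_symm hS')
  obtain ⟨τ₀, hτ₀⟩ := h.exists_of_mutatesTo hS h₀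
  obtain ⟨τ₁, hτ₁⟩ := h.exists_of_mutatesTo hS h₁
  obtain ⟨hdiag, hle, -⟩ := hτ₁.isTriangulation.mem_diagonals i
  obtain ⟨f, hf, hnonneg, hpat⟩ := hτ₀.exists_expansion hS₀.1 hdiag hle
  rw [← hτ₁.cluster_eq] at hf
  have hf0 : f ≠ 0 := by
    rintro rfl
    exact hS₁.cluster_ne_zero i (by simp [← hf, MvLaurent.eval])
  exact ⟨f, fun g => ⟨fun hg => MvLaurent.eval_injective hS₀.1 (hg.trans hf.symm), (· ▸ hf)⟩,
    MvLaurent.isLogConcave_of_isPatterned hf0 hnonneg hpat, fun m hm j => (hpat j).exponent m hm,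
    fun j => (hpat j).pattern⟩
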